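/- Let $n\ge 1$ and let $d_1,\dots,d_n\ge 2$ be integers. For every prime $p$ put $A_p=\mathbb{F}_p[[x_1,\dots,x_n]]$ and $f=x_1^{d_1}+\cdots+x_n^{d_n}\in A_p$. For integers $a,e\ge 0$ with $a\le p^e$ put $$\phi_{f,p}\left(\frac{a}{p^e}\right)=\frac{1}{p^{ne}}\dim_{\mathbb{F}_p}\left(A_p/(x_1^{p^e},\dots,x_n^{p^e},f^a)\right).$$ For every prime $p$ this is well defined (independent of the representation $a/p^e$) and extends to a (unique) continuous function $\phi_{f,p}:[0,1]\to\mathbb{R}$. For integers $\lambda\ge 0$ and $t\in[0,1]$ let $$C_\lambda(t)=\sum(\epsilon_0\cdots\epsilon_n)\left(\epsilon_0t+\frac{\epsilon_1}{d_1}+\cdots+\frac{\epsilon_n}{d_n}-2\lambda\right)^n,$$ where the sum is over all $\epsilon_0,\dots,\epsilon_n\in\{\pm1\}$ with $\epsilon_0t+\frac{\epsilon_1}{d_1}+\cdots+\frac{\epsilon_n}{d_n}-2\lambda\ge 0$. For each $t\in[0,1]$ only finitely many $C_\lambda(t)$ are nonzero. As $p\to\infty$ through the primes, the functions $\phi_{f,p}$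 converge uniformly on $[0,1]$ to the function $$\phi_f(t)=\frac{d_1\cdots d_n}{2^n\, n!}\left(C_0(t)+2\sum_{\lambda\ge 1}C_\lambda(t)\right).$$ Each $C_\lambda$ and the function $\phi_f$ are piecewise polynomial on $[0,1]$, that is, $[0,1]$ has a finite subdivision into closed intervals on each of which the function is given by a polynomial. -/

import Mathlib

open Filter Topology Set

noncomputable section

namespace DiagonalHypersurface

/-- The diagonal power series `x_1^{d_1} + ⋯ + x_n^{d_n}` in `𝔽_p⟦x_1, …, x_n⟧`. -/
def diagonal {n : ℕ} (d : Fin n → ℕ) (p : ℕ) : MvPowerSeries (Fin n) (ZMod p) :=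
  ∑ i, MvPowerSeries.X i ^ d i

/-- The ideal `(x_1^{p^e}, …, x_n^{p^e}, f^a)`, where `f = x_1^{d_1} + ⋯ + x_n^{d_n}`. -/
def frobIdeal {n : ℕ} (d : Fin n → ℕ) (p a e : ℕ) : Ideal (MvPowerSeries (Fin n) (ZMod p)) :=
  Ideal.span
    (Set.range (fun i : Fin n => (MvPowerSeries.X i : MvPowerSeries (Fin n) (ZMod p)) ^ p ^ e) ∪
      {diagonal d p ^ a})

/-- The number `p^{-ne} · dim (A_p / (x_1^{p^e}, …, x_n^{p^e}, f^a))`. -/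
def phiValue {n : ℕ} (d : Fin n → ℕ) (p a e : ℕ) : ℝ :=
  (Module.finrank (ZMod p) (MvPowerSeries (Fin n) (ZMod p) ⧸ frobIdeal d p a e) : ℝ) /
    (p : ℝ) ^ (n * e)

/-- The function `φ_{f,p}` on `[0,1]`: its value at `t` is the limit of the values at the
truncations `⌊t p^e⌋ / p^e` of `t`, as `e → ∞`. -/
def phi {n : ℕ} (d : Fin n → ℕ) (p : ℕ) (t : ℝ) : ℝ :=
  limUnder atTop (fun e : ℕ => phiValue d p ⌊t * (p : ℝ) ^ e⌋₊ e)

/-- The affine form `ε_0 t + ε_1 / d_1 + ⋯ + ε_n / d_n - 2 l`; a sign is an element of `ℤˣ`. -/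
def signForm {n : ℕ} (d : Fin n → ℕ) (l : ℕ) (ε : Fin (n + 1) → ℤˣ) (t : ℝ) : ℝ :=
  ((ε 0 : ℤ) : ℝ) * t + ∑ i : Fin n, ((ε i.succ : ℤ) : ℝ) / (d i : ℝ) - 2 * (l : ℝ)

/-- `C_l(t)`: the sum of `(ε_0 ⋯ ε_n) (ε_0 t + ε_1 / d_1 + ⋯ + ε_n / d_n - 2 l)^n` over the
choices of signs for which the form in the bracket is nonnegative. -/
def C {n : ℕ} (d : Fin n → ℕ) (l : ℕ) (t : ℝ) : ℝ :=
  ∑ ε : Fin (n + 1) → ℤˣ with 0 ≤ signForm d l ε t,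
    (∏ j, ((ε j : ℤ) : ℝ)) * signForm d l ε t ^ n

/-- `φ_f(t) = (d_1 ⋯ d_n) / (2^n n!) · (C_0(t) + 2 ∑_{l ≥ 1} C_l(t))`. -/
def phiLimit {n : ℕ} (d : Fin n → ℕ) (t : ℝ) : ℝ :=
  (∏ i, (d i : ℝ)) / (2 ^ n * (n.factorial : ℝ)) * (C d 0 t + 2 * ∑' l : ℕ, C d (l + 1) t)

/-- `g` is a piecewise polynomial function on `[a, b]`: there is a finite subdivision of `[a, b]`
such that `g` is given by a polynomial on each of its closed subintervals. -/
def IsPiecewisePolynomialOn (g : ℝ → ℝ) (a b : ℝ) : Prop :=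
  ∃ (m : ℕ) (s : ℕ → ℝ), Monotone s ∧ s 0 = a ∧ s m = b ∧
    ∀ i < m, ∃ P : Polynomial ℝ, ∀ t ∈ Icc (s i) (s (i + 1)), g t = P.eval t

end DiagonalHypersurface

end

/-! With `q = p^e`, the quotient in question is the cokernel of `T^a`, where `T` is multiplication
by `f` on `k[x_1,…,x_n]/(x_i^q)` and `k = 𝔽_p`. So everything reduces to the numbers `D(a) = dim V /
T^a V`, and to how they change when a variable is added, that is, when `T` becomes `T ⊗ 1 + 1 ⊗
x^d`.

Take `q = p`. As a module over `k[x^d]`, `k[x]/(x^p)` is a sum of `d` blocks `k[y]/(y^m)` with `m ≈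
p/d`. For one block let `D_m(a)` belong to `T + y`. Computing cokernels after tensoring with
`k[u]/(u²)` in two ways gives a discrete wave equation, `D_{m+2}(a+1) + D_m(a+1) = D_{m+1}(a+2) +
D_{m+1}(a)` (`cokerDim_clebschGordan`), valid while `m+1` and `a+1` are nonzero in `k`. The boundary
values are known: `0` at `a = 0`, and `m · dim V` at `a = p`, since `(T+y)^p = T^p + y^p = 0`. If
`D_1(a) = g(a/p)`, with `g` extended to `ℝ` by reflection in `0` and `1`, then `D_m(a)` is the sum
of `g` over a centred progression of `m` points with step `2/p` (`cokerDim_shiftEnd_one`).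

After division by `p`, adding a variable is thus a Riemann sum for the average of `g` over a window
of radius `1/d`. Starting from no variables, where `g` is a staircase, `φ_{f,p}(a/p)` is within
`O(1/p)` of an `n`-fold iterated window average of the staircase (`exists_abs_iterBlockSum_sub_le`).
The staircase is a combination of Heaviside functions with knots at even integers; each average is a
symmetric difference of an antiderivative, so truncated `n`-th powers appear, summed over signs.
This is the formula for `φ_f` (`phiLimit_eq_iterWindowAvg`).

Only the level `e = 1` is computed. Independence of the representation `a/p^e` comes from Frobenius
(`phiValue_prime_mul`), and a Lipschitz constant `d_1` that does not depend on `p` or `e`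
(`phiValue_lipschitz`) carries the estimate from the points `a/p` to all of `[0,1]`. -/

noncomputable section

namespace DiagonalHypersurface

/-! ### Cokernel dimensions of powers of an operator. -/

section Coker

variable {k : Type*} [Field k]
variable {V W : Type*} [AddCommGroup V] [Module k V] [AddCommGroup W] [Module k W]

/-- The dimension of the cokernel of `T ^ a`. -/
def cokerDim (T : Module.End k V) (a : ℕ) : ℕ :=
  Module.finrank k (V ⧸ LinearMap.range (T ^ a))

theorem finrank_quotient_of_surjective (f : V →ₗ[k] W) (hf : Function.Surjective f)
    (N : Submodule k V) (hN : LinearMap.ker f = N) :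
    Module.finrank k (V ⧸ N) = Module.finrank k W := by
  subst hN
  exact (f.quotKerEquivOfSurjective hf).finrank_eq

theorem pow_apply_intertwine (f : V → W) (T : Module.End k V) (S : Module.End k W)
    (h : ∀ v, f (T v) = S (f v)) (a : ℕ) (v : V) : f ((T ^ a) v) = (S ^ a) (f v) := by
  induction a generalizing v with
  | zero => simp
  | succ a ih => rw [pow_succ, pow_succ, Module.End.mul_apply, Module.End.mul_apply, ih, h]

theorem cokerDim_congr (e : V ≃ₗ[k] W) (T : Module.End k V) (S : Module.End k W)
    (h : ∀ v, e (T v) = S (e v)) (a : ℕ) : cokerDim T a = cokerDim S a := by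
  refine (Submodule.Quotient.equiv _ _ e ?_).finrank_eq
  have h' := pow_apply_intertwine e T S h a
  ext w
  constructor
  · rintro ⟨_, ⟨v, rfl⟩, rfl⟩
    exact ⟨e v, (h' v).symm⟩
  · rintro ⟨v, rfl⟩
    exact ⟨_, ⟨e.symm v, rfl⟩, by simp [h']⟩

theorem piMap_pow {ι : Type*} {M : ι → Type*} [∀ i, AddCommGroup (M i)] [∀ i, Module k (M i)]
    (T : ∀ i, Module.End k (M i)) (a : ℕ) (v : ∀ i, M i) (i : ι) :
    ((LinearMap.piMap T : Module.End k (∀ i, M i)) ^ a) v i = ((T i) ^ a) (v i) :=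
  pow_apply_intertwine (fun v : ∀ i, M i => v i) (LinearMap.piMap T) (T i) (fun _ => rfl) a v

theorem cokerDim_piMap {ι : Type*} [Fintype ι] {M : ι → Type*} [∀ i, AddCommGroup (M i)]
    [∀ i, Module k (M i)] [∀ i, FiniteDimensional k (M i)]
    (T : ∀ i, Module.End k (M i)) (a : ℕ) :
    cokerDim (LinearMap.piMap T : Module.End k (∀ i, M i)) a = ∑ i, cokerDim (T i) a := by
  classical
  have h : LinearMap.range ((LinearMap.piMap T : Module.End k (∀ i, M i)) ^ a) =
      Submodule.pi Set.univ (fun i => LinearMap.range ((T i) ^ a)) := by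
    ext w
    constructor
    · rintro ⟨v, rfl⟩ i -
      exact ⟨v i, (piMap_pow T a v i).symm⟩
    · intro hw
      choose v hv using fun i => hw i (Set.mem_univ i)
      exact ⟨v, funext fun i => (piMap_pow T a v i).trans (hv i)⟩
  unfold cokerDim
  rw [h, (Submodule.quotientPi _).finrank_eq, Module.finrank_pi_fintype]

theorem finrank_quotient_prod [FiniteDimensional k V] [FiniteDimensional k W]
    (A : Submodule k V) (B : Submodule k W) :
    Module.finrank k ((V × W) ⧸ A.prod B) =
      Module.finrank k (V ⧸ A) + Module.finrank k (W ⧸ B) := by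
  rw [← Module.finrank_prod]
  refine finrank_quotient_of_surjective (A.mkQ.prodMap B.mkQ) ?_ _ ?_
  · rintro ⟨x, y⟩
    obtain ⟨x, rfl⟩ := A.mkQ_surjective x
    obtain ⟨y, rfl⟩ := B.mkQ_surjective y
    exact ⟨(x, y), rfl⟩
  · rw [LinearMap.ker_prodMap, Submodule.ker_mkQ, Submodule.ker_mkQ]

theorem cokerDim_prodMap [FiniteDimensional k V] [FiniteDimensional k W]
    (T : Module.End k V) (S : Module.End k W) (a : ℕ) :
    cokerDim (T.prodMap S : Module.End k (V × W)) a = cokerDim T a + cokerDim S a := by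
  unfold cokerDim
  rw [← finrank_quotient_prod, ← LinearMap.range_prodMap]
  have h : (T.prodMap S : Module.End k (V × W)) ^ a = LinearMap.prodMap (T ^ a) (S ^ a) :=
    LinearMap.ext fun x => Prod.ext
    (pow_apply_intertwine (fun v : V × W => v.1) (T.prodMap S) T (fun _ => rfl) a x)
    (pow_apply_intertwine (fun v : V × W => v.2) (T.prodMap S) S (fun _ => rfl) a x)
  rw [h]

theorem cokerDim_zero (T : Module.End k V) : cokerDim T 0 = 0 := by
  have h : LinearMap.range (T ^ 0) = ⊤ := by
    rw [pow_zero]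
    exact LinearMap.range_eq_top.2 fun v => ⟨v, rfl⟩
  unfold cokerDim
  rw [h]
  exact Module.finrank_zero_of_subsingleton

theorem cokerDim_of_pow_eq_zero (T : Module.End k V) {a : ℕ} (h : T ^ a = 0) :
    cokerDim T a = Module.finrank k V := by
  unfold cokerDim
  rw [h, LinearMap.range_zero]
  exact (Submodule.quotEquivOfEqBot ⊥ rfl).finrank_eq

theorem cokerDim_le_succ [FiniteDimensional k V] (T : Module.End k V) (a : ℕ) :
    cokerDim T a ≤ cokerDim T (a + 1) := by
  unfold cokerDim
  refine LinearMap.finrank_le_finrank_of_surjective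
    (f := Submodule.factor (?_ : LinearMap.range (T ^ (a + 1)) ≤ LinearMap.range (T ^ a)))
    (Submodule.factor_surjective _)
  rintro _ ⟨v, rfl⟩
  exact ⟨T v, by rw [pow_succ]; rfl⟩

/-- By rank–nullity the claim is one about kernels: `T^a` maps `ker T^(a+1)` into `ker T` with
kernel inside `ker T^a`. -/
theorem cokerDim_succ_le [FiniteDimensional k V] (T : Module.End k V) (a : ℕ) :
    cokerDim T (a + 1) ≤ cokerDim T a + cokerDim T 1 := by
  unfold cokerDim
  have h1 := Submodule.finrank_quotient_add_finrank (LinearMap.range (T ^ (a + 1)))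
  have h2 := Submodule.finrank_quotient_add_finrank (LinearMap.range (T ^ a))
  have h3 := Submodule.finrank_quotient_add_finrank (LinearMap.range (T ^ 1))
  have k1 := LinearMap.finrank_range_add_finrank_ker (T ^ (a + 1))
  have k2 := LinearMap.finrank_range_add_finrank_ker (T ^ a)
  have k3 := LinearMap.finrank_range_add_finrank_ker (T ^ 1)
  have h4 : Module.finrank k (LinearMap.ker (T ^ (a + 1))) ≤
      Module.finrank k (LinearMap.ker (T ^ a)) + Module.finrank k (LinearMap.ker (T ^ 1)) := by
    let f : LinearMap.ker (T ^ (a + 1)) →ₗ[k] LinearMap.ker (T ^ 1) :=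
      LinearMap.restrict (T ^ a) (fun v hv => by
        rw [LinearMap.mem_ker] at hv ⊢
        rw [← hv, ← Module.End.mul_apply, ← pow_add, add_comm])
    have hf := LinearMap.finrank_range_add_finrank_ker f
    have hr : Module.finrank k (LinearMap.range f) ≤ Module.finrank k (LinearMap.ker (T ^ 1)) :=
      Submodule.finrank_le _
    have hk : Module.finrank k (LinearMap.ker f) ≤ Module.finrank k (LinearMap.ker (T ^ a)) := by
      let g : LinearMap.ker f →ₗ[k] LinearMap.ker (T ^ a) :=
        LinearMap.codRestrict _
          ((LinearMap.ker (T ^ (a + 1))).subtype ∘ₗ (LinearMap.ker f).subtype) (fun v => by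
            have hv := v.2
            rw [LinearMap.mem_ker] at hv ⊢
            exact congrArg Subtype.val hv)
      refine LinearMap.finrank_le_finrank_of_injective (f := g) fun x y hxy => ?_
      exact Subtype.ext (Subtype.ext (congrArg (fun z : LinearMap.ker (T ^ a) => (z : V)) hxy))
    omega
  omega

/-- The operator `T ⊗ 1 + 1 ⊗ u` on `V ⊗ k[u]/(u²)`. -/
def doubleEnd (T : Module.End k V) : Module.End k (V × V) where
  toFun v := (T v.1, v.1 + T v.2)
  map_add' v w := by ext <;> simp; abel
  map_smul' c v := by ext <;> simp

theorem doubleEnd_pow (T : Module.End k V) (a : ℕ) (v : V × V) :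
    (doubleEnd T ^ (a + 1)) v =
      ((T ^ (a + 1)) v.1, ((a + 1 : ℕ) : k) • (T ^ a) v.1 + (T ^ (a + 1)) v.2) := by
  induction a generalizing v with
  | zero => simp [doubleEnd]
  | succ a ih =>
    rw [pow_succ, Module.End.mul_apply, ih]
    refine Prod.ext ?_ ?_
    · simp only [doubleEnd, LinearMap.coe_mk, AddHom.coe_mk, ← Module.End.mul_apply, ← pow_succ]
    · simp only [doubleEnd, LinearMap.coe_mk, AddHom.coe_mk, ← Module.End.mul_apply, ← pow_succ,
        map_add]
      rw [← add_assoc]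
      congr 1
      rw [Nat.cast_succ (a + 1), add_smul, one_smul]

/-- Since `u² = 0`, `(T + u)^(a+1) = T^(a+1) + (a+1) u T^a`. With `a+1` invertible, a unipotent
change of coordinates makes its range a product of ranges. -/
theorem cokerDim_doubleEnd [FiniteDimensional k V] (T : Module.End k V) (a : ℕ)
    (ha : ((a + 1 : ℕ) : k) ≠ 0) :
    cokerDim (doubleEnd T) (a + 1) = cokerDim T (a + 2) + cokerDim T a := by
  unfold cokerDim
  rw [← finrank_quotient_prod]
  have hd := doubleEnd_pow T a
  generalize ((a + 1 : ℕ) : k) = c at ha hd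
  -- Subtracting `c⁻¹ T` of the second coordinate cancels `T^(a+1) v.1` in the first, leaving `-c⁻¹
  -- T^(a+2) v.2`; the second coordinate is `T^a (c v.1 + T v.2)`.
  let α : (V × V) ≃ₗ[k] (V × V) :=
    LinearEquiv.ofLinearMap
      ((LinearMap.fst k V V - c⁻¹ • T ∘ₗ LinearMap.snd k V V).prod (LinearMap.snd k V V))
      ((LinearMap.fst k V V + c⁻¹ • T ∘ₗ LinearMap.snd k V V).prod (LinearMap.snd k V V))
      (by ext <;> simp) (by ext <;> simp)
  have hα : ∀ x, α x = (x.1 - c⁻¹ • T x.2, x.2) := fun x => rfl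
  have hT : ∀ (b : ℕ) (v : V), T ((T ^ b) v) = (T ^ (b + 1)) v := fun b v => by
    rw [pow_succ']; rfl
  have hT' : ∀ (b : ℕ) (v : V), (T ^ b) (T v) = (T ^ (b + 1)) v := fun b v => by
    rw [pow_succ]; rfl
  have hT2 : T ^ (a + 2) = T ^ (a + 1 + 1) := rfl
  refine (Submodule.Quotient.equiv _ _ α ?_).finrank_eq
  rw [hT2]
  ext ⟨x, y⟩
  constructor
  · rintro ⟨_, ⟨v, rfl⟩, h⟩
    rw [LinearEquiv.coe_coe, hα, hd] at h
    obtain ⟨rfl, rfl⟩ := Prod.mk.inj h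
    refine ⟨⟨-(c⁻¹ • v.2), ?_⟩, ⟨c • v.1 + T v.2, ?_⟩⟩
    · simp only [map_neg, map_smul, map_add, hT, smul_add, smul_smul, inv_mul_cancel₀ ha, one_smul]
      simp
    · simp only [map_add, map_smul, hT']
  · rintro ⟨⟨u, rfl⟩, ⟨w, rfl⟩⟩
    refine ⟨_, ⟨(c⁻¹ • (w + c • T u), -(c • u)), rfl⟩, ?_⟩
    rw [LinearEquiv.coe_coe, hα, hd]
    refine Prod.ext ?_ ?_
    · simp [hT, hT', ha]
    · simp [hT', ha]

/-- The shift by `d` on `V ⊗ k[x]/(x^q)`. -/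
def shift (k : Type*) [Field k] (V : Type*) [AddCommGroup V] [Module k V] (d q : ℕ) :
    Module.End k (Fin q → V) where
  toFun v b := if d ≤ (b : ℕ) then v ⟨b - d, by omega⟩ else 0
  map_add' v w := by ext b; simp only [Pi.add_apply]; split_ifs <;> simp
  map_smul' c v := by ext b; simp

/-- The operator `T ⊗ 1 + 1 ⊗ x^d` on `V ⊗ k[x]/(x^q)`. -/
def shiftEnd (T : Module.End k V) (d q : ℕ) : Module.End k (Fin q → V) :=
  T.compLeft (Fin q) + shift k V d q

theorem shiftEnd_apply (T : Module.End k V) (d q : ℕ) (v : Fin q → V) (b : Fin q) :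
    shiftEnd T d q v b = T (v b) + if d ≤ (b : ℕ) then v ⟨b - d, by omega⟩ else 0 := rfl

theorem shift_pow_apply (d q a : ℕ) (v : Fin q → V) (b : Fin q) :
    ((shift k V d q) ^ a) v b = if d * a ≤ (b : ℕ) then v ⟨b - d * a, by omega⟩ else 0 := by
  induction a generalizing b with
  | zero => simp
  | succ a ih =>
    rw [pow_succ', Module.End.mul_apply]
    have h : ∀ w : Fin q → V, shift k V d q w b =
      if d ≤ (b : ℕ) then w ⟨b - d, by omega⟩ else 0 := fun _ => rfl
    rw [h]
    simp only [ih, mul_add, mul_one]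
    by_cases h1 : d * a + d ≤ (b : ℕ)
    · rw [if_pos (by omega), if_pos (by omega), if_pos h1]
      congr 2
      omega
    · rw [if_neg h1]
      split_ifs with h2 h3
      · omega
      · rfl
      · rfl

/-- The two summands commute, so in characteristic `p` the `p`-th power is additive; `q ≤ d * p`
kills the power of the shift. -/
theorem shiftEnd_pow_eq_zero {p : ℕ} (hp : p.Prime) [CharP k p] (T : Module.End k V)
    (hT : T ^ p = 0) (d q : ℕ) (hq : q ≤ d * p) : shiftEnd T d q ^ p = 0 := by
  have hc : Commute (T.compLeft (Fin q)) (shift k V d q) := by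
    refine LinearMap.ext fun v => funext fun b => ?_
    change T (if d ≤ (b : ℕ) then v ⟨b - d, _⟩ else 0) = if d ≤ (b : ℕ) then T _ else 0
    split_ifs <;> simp
  obtain ⟨r, hr⟩ := hc.exists_add_pow_prime_eq hp
  have h0 : ((p : ℕ) : Module.End k (Fin q → V)) = 0 := by
    rw [← map_natCast (algebraMap k (Module.End k (Fin q → V))) p, CharP.cast_eq_zero, map_zero]
  have h1 : (T.compLeft (Fin q)) ^ p = 0 := by
    refine LinearMap.ext fun v => funext fun b => ?_
    rw [pow_apply_intertwine (fun v : Fin q → V => v b) (T.compLeft (Fin q)) T (fun _ => rfl), hT]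
    rfl
  have h2 : (shift k V d q) ^ p = 0 := by
    refine LinearMap.ext fun v => funext fun b => ?_
    rw [shift_pow_apply, if_neg (by omega)]
    rfl
  rw [shiftEnd, hr, h0, h1, h2]
  simp

end Coker

/-! ### Adding one variable: residue blocks, Clebsch–Gordan recursion, profiles. -/

section Blocks

variable {k : Type*} [Field k]
variable {V : Type*} [AddCommGroup V] [Module k V]

/-- The number of integers in `[0, q)` that are congruent to `r` modulo `d`, for `r < d`. -/
def blockLength (q d r : ℕ) : ℕ := (q + (d - 1 - r)) / d

theorem lt_blockLength_iff {q d r j : ℕ} (hr : r < d) :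
    j < blockLength q d r ↔ r + d * j < q := by
  unfold blockLength
  rw [Nat.lt_iff_add_one_le, Nat.le_div_iff_mul_le (by omega), add_mul, one_mul, mul_comm d j]
  omega

theorem mod_add_mul_div_lt_blockLength {q d b : ℕ} (hd : 0 < d) (hb : b < q) :
    b / d < blockLength q d (b % d) := by
  rw [lt_blockLength_iff (Nat.mod_lt _ hd), Nat.mod_add_div]
  exact hb

/-- Splitting `k[x]/(x^q)` into the residue classes of exponents modulo `d`. -/
def blockEquiv (k : Type*) [Field k] (V : Type*) [AddCommGroup V] [Module k V] (q d : ℕ)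
    (hd : 0 < d) :
    (Fin q → V) ≃ₗ[k] ((r : Fin d) → Fin (blockLength q d r) → V) where
  toFun v r j := v ⟨r + d * j, (lt_blockLength_iff r.2).1 j.2⟩
  map_add' _ _ := rfl
  map_smul' _ _ := rfl
  invFun w b := w ⟨b % d, Nat.mod_lt _ hd⟩ ⟨b / d, mod_add_mul_div_lt_blockLength hd b.2⟩
  left_inv v := by
    ext b
    simp only [Nat.mod_add_div, Fin.eta]
  right_inv w := by
    have key : ∀ (r r' : Fin d) (j : Fin (blockLength q d r)) (j' : Fin (blockLength q d r')),
        r = r' → (j : ℕ) = j' → w r j = w r' j' := by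
      rintro r r' j j' rfl h
      rw [Fin.ext h]
    ext r j
    refine key _ _ _ _ (Fin.ext ?_) ?_
    · simp [Nat.mod_eq_of_lt r.2]
    · simp only
      rw [Nat.add_mul_div_left _ _ hd, Nat.div_eq_of_lt r.2, zero_add]

/-- Multiplication by `x^d` preserves the exponent modulo `d` and acts on each residue class as a
shift by one. -/
theorem cokerDim_shiftEnd [FiniteDimensional k V] (T : Module.End k V) (d q a : ℕ) (hd : 0 < d) :
    cokerDim (shiftEnd T d q) a =
      ∑ r : Fin d, cokerDim (shiftEnd T 1 (blockLength q d r)) a := by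
  rw [← cokerDim_piMap]
  refine cokerDim_congr (blockEquiv k V q d hd) _ _ (fun v => ?_) a
  funext r j
  have hr := r.2
  change shiftEnd T d q v _ = shiftEnd T 1 _ (blockEquiv k V q d hd v r) j
  rw [shiftEnd_apply, shiftEnd_apply]
  congr 1
  obtain ⟨i, hi⟩ := j
  rcases i with _ | i
  · simp only [mul_zero, add_zero]
    rw [if_neg (by omega), if_neg (by omega)]
  · simp only []
    rw [if_pos (by rw [mul_add]; omega), if_pos (by omega)]
    change v _ = v _
    congr 1
    apply Fin.ext
    simp only [mul_add, mul_one, Nat.add_sub_cancel]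
    omega

/-- The change of basis behind
`k[u]/(u²) ⊗ k[y]/(y^(m+1)) = k[T]/(T^(m+2)) ⊕ k[T]/(T^m)`, where `T = u + y`. -/
def clebschGordan (k : Type*) [Field k] (V : Type*) [AddCommGroup V] [Module k V] (m : ℕ) :
    ((Fin (m + 2) → V) × (Fin m → V)) →ₗ[k] ((Fin (m + 1) → V) × (Fin (m + 1) → V)) where
  -- The generators are `1` and `y - m u`. Indeed `T^i = y^i + i u y^(i-1)` and `T^j (y - m u) =
  -- y^(j+1) + (j - m) u y^j`, which vanishes at `j = m`. The pair lists the coefficients of `u^0`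
  -- and `u^1`.
  toFun x :=
    (fun i => x.1 i.castSucc + if h : 1 ≤ (i : ℕ) then x.2 ⟨i - 1, by omega⟩ else 0,
     fun i => ((i : ℕ) + 1 : k) • x.1 i.succ +
       if h : (i : ℕ) < m then ((i : ℕ) - m : k) • x.2 ⟨i, h⟩ else 0)
  map_add' x y := by
    refine Prod.ext (funext fun i => ?_) (funext fun i => ?_)
    · simp only [Prod.fst_add, Prod.snd_add, Pi.add_apply]
      split_ifs <;> abel
    · simp only [Prod.fst_add, Prod.snd_add, Pi.add_apply, smul_add]
      split_ifs <;> abel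
  map_smul' c x := by
    refine Prod.ext (funext fun i => ?_) (funext fun i => ?_)
    · simp only [Prod.smul_fst, Prod.smul_snd, Pi.smul_apply, RingHom.id_apply, smul_add]
      split_ifs <;> simp
    · simp only [Prod.smul_fst, Prod.smul_snd, Pi.smul_apply, RingHom.id_apply, smul_add,
        smul_comm c]
      split_ifs
      · rw [smul_comm (((i : ℕ) : k) - m) c]
      · simp

theorem clebschGordan_fst (m : ℕ) (x : (Fin (m + 2) → V) × (Fin m → V)) (i : Fin (m + 1)) :
    (clebschGordan k V m x).1 i =
      x.1 i.castSucc + if h : 1 ≤ (i : ℕ) then x.2 ⟨i - 1, by omega⟩ else 0 := rfl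

theorem clebschGordan_snd (m : ℕ) (x : (Fin (m + 2) → V) × (Fin m → V)) (i : Fin (m + 1)) :
    (clebschGordan k V m x).2 i =
      ((i : ℕ) + 1 : k) • x.1 i.succ +
       if h : (i : ℕ) < m then ((i : ℕ) - m : k) • x.2 ⟨i, h⟩ else 0 := rfl

/-- In each degree the system for `v (i+1)` and `w i` has determinant `-(m+1)` up to sign, whatever
`i` is. -/
theorem clebschGordan_injective (m : ℕ) (hm : ((m + 1 : ℕ) : k) ≠ 0) :
    Function.Injective (clebschGordan k V m) := by
  rw [← LinearMap.ker_eq_bot, LinearMap.ker_eq_bot']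
  rintro ⟨v, w⟩ h
  have h1 : ∀ i, (clebschGordan k V m (v, w)).1 i = 0 := fun i => by rw [h]; rfl
  have h2 : ∀ i, (clebschGordan k V m (v, w)).2 i = 0 := fun i => by rw [h]; rfl
  simp only [clebschGordan_fst, clebschGordan_snd] at h1 h2
  have hw : w = 0 := by
    funext i
    have e1 := h1 i.succ
    have e2 := h2 i.castSucc
    rw [dif_pos (by simp)] at e1
    rw [dif_pos (by simp)] at e2
    simp only [Fin.val_succ, Nat.add_sub_cancel, Fin.eta, Fin.val_castSucc] at e1 e2
    have e3 : v i.castSucc.succ = - w i := eq_neg_of_add_eq_zero_left e1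
    rw [e3, smul_neg, ← neg_smul, ← add_smul] at e2
    refine (smul_eq_zero.1 e2).resolve_left ?_
    intro h0
    apply hm
    push_cast
    linear_combination -h0
  subst hw
  have hv : v = 0 := by
    funext i
    refine Fin.lastCases ?_ (fun i => ?_) i
    · have e := h2 (Fin.last m)
      simp only [Fin.val_last, lt_irrefl, dite_false, add_zero, Fin.succ_last] at e
      refine (smul_eq_zero.1 e).resolve_left ?_
      exact_mod_cast hm
    · have e := h1 i
      simpa using e
  rw [hv]
  rfl

theorem clebschGordan_intertwine (T : Module.End k V) (m : ℕ)
    (x : (Fin (m + 2) → V) × (Fin m → V)) :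
    clebschGordan k V m ((shiftEnd T 1 (m + 2)).prodMap (shiftEnd T 1 m) x) =
      doubleEnd (shiftEnd T 1 (m + 1)) (clebschGordan k V m x) := by
  obtain ⟨v, w⟩ := x
  have hD : ∀ y : (Fin (m + 1) → V) × (Fin (m + 1) → V), doubleEnd (shiftEnd T 1 (m + 1)) y =
    (shiftEnd T 1 (m + 1) y.1, y.1 + shiftEnd T 1 (m + 1) y.2) := fun _ => rfl
  rw [hD]
  refine Prod.ext (funext fun i => ?_) (funext fun i => ?_)
  · simp only [clebschGordan_fst, LinearMap.prodMap_apply, shiftEnd_apply]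
    obtain ⟨i, hi⟩ := i
    rcases i with _ | _ | i
    · simp
    · simp; abel
    · simp; abel
  · simp only [Pi.add_apply, clebschGordan_fst, clebschGordan_snd, LinearMap.prodMap_apply,
      shiftEnd_apply]
    obtain ⟨i, hi⟩ := i
    rcases i with _ | i
    · by_cases h : 0 < m <;> simp [h] <;> abel
    · have hi' : i < m := by omega
      by_cases h : i + 1 < m
      · simp [h, hi']
        module
      · have hm : m = i + 1 := by omega
        subst hm
        simp
        module

/-- Both sides compute the cokernel of the `(a+1)`-st power of `T + y + u` on `V ⊗ k[y]/(y^(m+1)) ⊗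
k[u]/(u²)`: the left side merges `u` with `y`, the right side treats `u` last. -/
theorem cokerDim_clebschGordan [FiniteDimensional k V] (T : Module.End k V) (m a : ℕ)
    (hm : ((m + 1 : ℕ) : k) ≠ 0) (ha : ((a + 1 : ℕ) : k) ≠ 0) :
    cokerDim (shiftEnd T 1 (m + 2)) (a + 1) + cokerDim (shiftEnd T 1 m) (a + 1) =
      cokerDim (shiftEnd T 1 (m + 1)) (a + 2) + cokerDim (shiftEnd T 1 (m + 1)) a := by
  rw [← cokerDim_doubleEnd _ _ ha, ← cokerDim_prodMap]
  refine cokerDim_congr (LinearMap.linearEquivOfInjective (clebschGordan k V m)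
    (clebschGordan_injective m hm) ?_) _ _ (clebschGordan_intertwine T m) _
  simp only [Module.finrank_prod, Module.finrank_pi_fintype, Finset.sum_const, Finset.card_univ,
    Fintype.card_fin, smul_eq_mul]
  ring

/-- `g` encodes the cokernel dimensions `dim V / T^a V`, `a ≤ p`, of an operator with `T^p = 0`,
extended by the reflections in `0` and in `1`. -/
structure IsProfile (p : ℕ) (T : Module.End k V) (g : ℝ → ℝ) : Prop where
  pow_eq_zero : T ^ p = 0
  odd : ∀ x, g (-x) = -g x
  reflect : ∀ x, g (1 + x) + g (1 - x) = 2 * g 1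
  eq_cokerDim : ∀ a ≤ p, (cokerDim T a : ℝ) = g (a / p)

/-- The sum of `g` over the centred arithmetic progression of length `m` and step `2 / p`. -/
def progSum (p m : ℕ) (g : ℝ → ℝ) (x : ℝ) : ℝ :=
  ∑ j ∈ Finset.range m, g (x + (m - 1 - 2 * j) / p)

theorem progSum_neg {p m : ℕ} {g : ℝ → ℝ} (h : ∀ x, g (-x) = -g x) (x : ℝ) :
    progSum p m g (-x) = -progSum p m g x := by
  unfold progSum
  rw [← Finset.sum_range_reflect, ← Finset.sum_neg_distrib]
  refine Finset.sum_congr rfl fun j hj => ?_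
  rw [Finset.mem_range] at hj
  rw [← h, Nat.sub_sub, Nat.cast_sub (by omega)]
  congr 1
  push_cast
  ring

theorem progSum_reflect {p m : ℕ} {g : ℝ → ℝ} (h : ∀ x, g (1 + x) + g (1 - x) = 2 * g 1) (x : ℝ) :
    progSum p m g (1 + x) + progSum p m g (1 - x) = m * (2 * g 1) := by
  have h1 : progSum p m g (1 - x) =
      ∑ j ∈ Finset.range m, g (1 - (x + (m - 1 - 2 * j) / p)) := by
    unfold progSum
    rw [← Finset.sum_range_reflect]
    refine Finset.sum_congr rfl fun j hj => ?_
    rw [Finset.mem_range] at hj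
    rw [Nat.sub_sub, Nat.cast_sub (by omega)]
    congr 1
    push_cast
    ring
  rw [h1]
  unfold progSum
  rw [← Finset.sum_add_distrib, Finset.sum_congr rfl (g := fun _ => 2 * g 1)]
  · simp
  · intro j _
    rw [← h (x + (m - 1 - 2 * j) / p), add_assoc]

/-- Same recursion as in `cokerDim_clebschGordan`, with `x = (a+1)/p`: moving the centre by `1/p`
and changing the length by one both add or drop an end point. -/
theorem progSum_recursion (p m : ℕ) (g : ℝ → ℝ) (x : ℝ) :
    progSum p (m + 2) g x + progSum p m g x =
      progSum p (m + 1) g (x + 1 / p) + progSum p (m + 1) g (x - 1 / p) := by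
  have e1 : ∀ j : ℕ, x + (((m + 2 : ℕ) : ℝ) - 1 - 2 * j) / p =
      x + 1 / p + (((m + 1 : ℕ) : ℝ) - 1 - 2 * j) / p := fun j => by push_cast; ring
  have e2 : ∀ j : ℕ, x - 1 / p + (((m + 1 : ℕ) : ℝ) - 1 - 2 * j) / p =
      x + ((m : ℝ) - 1 - 2 * j) / p := fun j => by push_cast; ring
  have e3 : x + 1 / p + (((m + 1 : ℕ) : ℝ) - 1 - 2 * (m + 1 : ℕ)) / p =
    x + ((m : ℝ) - 1 - 2 * m) / p := by push_cast; ring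
  have h1 : progSum p (m + 2) g x =
      progSum p (m + 1) g (x + 1 / p) + g (x + ((m : ℝ) - 1 - 2 * m) / p) := by
    unfold progSum
    rw [Finset.sum_range_succ _ (m + 1)]
    simp only [e1]
    rw [e3]
  have h2 : progSum p (m + 1) g (x - 1 / p) =
      progSum p m g x + g (x + ((m : ℝ) - 1 - 2 * m) / p) := by
    unfold progSum
    simp only [e2]
    rw [Finset.sum_range_succ]
  rw [h1, h2]
  ring

/-- Induction on `m`: both sides obey the same two-step recursion for `0 < a < p` and agree at `m =
0`, `m = 1`, `a = 0` and `a = p`. The symmetries of `g` make the two boundary values correct. -/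
theorem cokerDim_shiftEnd_one {p : ℕ} (hp : p.Prime) [CharP k p] [FiniteDimensional k V]
    {T : Module.End k V} {g : ℝ → ℝ} (hg : IsProfile p T g) (m : ℕ) (hm : m ≤ p) (a : ℕ)
    (ha : a ≤ p) : (cokerDim (shiftEnd T 1 m) a : ℝ) = progSum p m g (a / p) := by
  have hp0 : (p : ℝ) ≠ 0 := by exact_mod_cast hp.ne_zero
  have hne : ∀ i, i + 1 < p → ((i + 1 : ℕ) : k) ≠ 0 := fun i hi h => by
    rw [CharP.cast_eq_zero_iff k p] at h
    exact absurd (Nat.le_of_dvd (by omega) h) (by omega)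
  -- At `a = p` the operator power is zero, so the left side is `m · dim V = m · g 1`; the right
  -- side follows from the reflection in `1`.
  have hend : ∀ m ≤ p, (cokerDim (shiftEnd T 1 m) p : ℝ) = progSum p m g 1 := fun m hm => by
    have h1 := progSum_reflect (p := p) (m := m) hg.reflect 0
    have h2 := hg.eq_cokerDim p le_rfl
    rw [cokerDim_of_pow_eq_zero _ hg.pow_eq_zero, div_self hp0] at h2
    rw [cokerDim_of_pow_eq_zero _
      (shiftEnd_pow_eq_zero hp T hg.pow_eq_zero 1 m (by omega)), Module.finrank_pi_fintype]
    simp only [add_zero, sub_zero] at h1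
    simp only [Finset.sum_const, Finset.card_univ, Fintype.card_fin, smul_eq_mul, Nat.cast_mul]
    rw [h2]
    linarith
  have hstart : ∀ m, (cokerDim (shiftEnd T 1 m) 0 : ℝ) = progSum p m g 0 := fun m => by
    have h1 := progSum_neg (p := p) (m := m) hg.odd 0
    rw [neg_zero] at h1
    rw [cokerDim_zero, Nat.cast_zero]
    linarith
  induction m using Nat.strong_induction_on generalizing a with
  | _ m ih =>
    rcases m with _ | _ | m
    · rw [progSum, Finset.sum_range_zero, Nat.cast_eq_zero]
      exact Module.finrank_zero_of_subsingleton
    · rw [progSum, Finset.sum_range_one]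
      have : cokerDim (shiftEnd T 1 1) a = cokerDim T a := by
        refine cokerDim_congr (LinearEquiv.funUnique (Fin 1) k V) _ _ (fun v => ?_) a
        simp [shiftEnd_apply]
      rw [zero_add, this, hg.eq_cokerDim a ha]
      simp
    · rcases Nat.eq_zero_or_pos a with rfl | ha0
      · rw [hstart]; simp
      rcases ha.eq_or_lt with rfl | hap
      · rw [hend _ hm, div_self hp0]
      obtain ⟨b, rfl⟩ : ∃ b, a = b + 1 := ⟨a - 1, by omega⟩
      have h1 := cokerDim_clebschGordan T m b (hne m (by omega)) (hne b hap)
      have h2 := progSum_recursion p m g ((b + 1 : ℕ) / p)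
      have e1 : ((b + 1 : ℕ) / p : ℝ) + 1 / p = (b + 2 : ℕ) / p := by push_cast; ring
      have e2 : ((b + 1 : ℕ) / p : ℝ) - 1 / p = b / p := by push_cast; ring
      have h3 := ih m (by omega) (by omega) (b + 1) ha
      have h4 := ih (m + 1) (by omega) (by omega) (b + 2) (by omega)
      have h5 := ih (m + 1) (by omega) (by omega) b (by omega)
      rw [e1, e2, ← h3, ← h4, ← h5] at h2
      have h6 : ((cokerDim (shiftEnd T 1 (m + 2)) (b + 1) + cokerDim (shiftEnd T 1 m) (b + 1) : ℕ)
        : ℝ) = ((cokerDim (shiftEnd T 1 (m + 1)) (b + 2) +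
          cokerDim (shiftEnd T 1 (m + 1)) b : ℕ) : ℝ) := by rw [h1]
      push_cast at h6
      linarith

/-- The sum of `g` over the `p` points attached to the decomposition of `k[x]/(x^p)` as a module
over `k[x^d]`. -/
def blockSum (p d : ℕ) (g : ℝ → ℝ) (x : ℝ) : ℝ :=
  ∑ r : Fin d, progSum p (blockLength p d r) g x

theorem blockLength_le {p d r : ℕ} (hr : r < d) : blockLength p d r ≤ p := by
  by_contra! h
  rw [lt_blockLength_iff hr] at h
  nlinarith

/-- The inductive step over the variables: the symmetries survive because each progression is
centred. -/
theorem IsProfile.shiftEnd {p : ℕ} (hp : p.Prime) [CharP k p] [FiniteDimensional k V]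
    {T : Module.End k V} {g : ℝ → ℝ} (hg : IsProfile p T g) {d : ℕ} (hd : 0 < d) :
    IsProfile p (shiftEnd T d p) (blockSum p d g) where
  pow_eq_zero := shiftEnd_pow_eq_zero hp T hg.pow_eq_zero d p (Nat.le_mul_of_pos_left p hd)
  odd x := by
    unfold blockSum
    rw [← Finset.sum_neg_distrib]
    exact Finset.sum_congr rfl fun r _ => progSum_neg hg.odd x
  reflect x := by
    have h0 : ∀ x, blockSum p d g (1 + x) + blockSum p d g (1 - x) =
        ∑ r : Fin d, (blockLength p d r : ℝ) * (2 * g 1) := fun x => by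
      unfold blockSum
      rw [← Finset.sum_add_distrib]
      exact Finset.sum_congr rfl fun r _ => progSum_reflect hg.reflect x
    have h1 := h0 0
    rw [add_zero, sub_zero] at h1
    rw [h0, ← h1]
    ring
  eq_cokerDim a ha := by
    rw [cokerDim_shiftEnd T d p a hd, Nat.cast_sum]
    exact Finset.sum_congr rfl fun r _ =>
      cokerDim_shiftEnd_one hp hg _ (blockLength_le r.2) a ha

end Blocks

/-! ### The truncated polynomial ring in the monomial basis. -/

section Box

variable {k : Type*} [Field k]

/-- Multiplication by `x_1^{d_1} + ⋯ + x_n^{d_n}` on `k[x_1, …, x_n]/(x_1^q, …, x_n^q)`, in the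
basis of monomials. -/
def diagOp (k : Type*) [Field k] {n : ℕ} (d : Fin n → ℕ) (q : ℕ) :
    Module.End k ((Fin n → Fin q) → k) where
  toFun v b := ∑ i, if d i ≤ (b i : ℕ) then v (Function.update b i ⟨b i - d i, by omega⟩) else 0
  map_add' v w := by
    ext b
    simp only [Pi.add_apply, ← Finset.sum_add_distrib]
    refine Finset.sum_congr rfl fun i _ => ?_
    split_ifs <;> simp
  map_smul' c v := by
    ext b
    simp [Finset.mul_sum]

theorem diagOp_apply {n : ℕ} (d : Fin n → ℕ) (q : ℕ) (v : (Fin n → Fin q) → k)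
    (b : Fin n → Fin q) :
    diagOp k d q v b =
      ∑ i, if d i ≤ (b i : ℕ) then v (Function.update b i ⟨b i - d i, by omega⟩) else 0 := rfl

/-- Separating the first variable. -/
def boxConsEquiv (k : Type*) [Field k] (n q : ℕ) :
    ((Fin (n + 1) → Fin q) → k) ≃ₗ[k] (Fin q → (Fin n → Fin q) → k) where
  toFun v c b := v (Fin.cons c b)
  map_add' _ _ := rfl
  map_smul' _ _ := rfl
  invFun w b := w (b 0) (Fin.tail b)
  left_inv v := by ext b; simp
  right_inv w := by ext c b; simp

theorem boxConsEquiv_diagOp {n : ℕ} (d : Fin (n + 1) → ℕ) (q : ℕ)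
    (v : (Fin (n + 1) → Fin q) → k) :
    boxConsEquiv k n q (diagOp k d q v) =
      shiftEnd (diagOp k (Fin.tail d) q) (d 0) q (boxConsEquiv k n q v) := by
  funext c b
  rw [shiftEnd_apply, Pi.add_apply, diagOp_apply]
  change diagOp k d q v (Fin.cons c b) = _
  rw [diagOp_apply, Fin.sum_univ_succ, add_comm]
  congr 1
  · refine Finset.sum_congr rfl fun i _ => ?_
    simp only [Fin.cons_succ]
    by_cases h : Fin.tail d i ≤ (b i : ℕ)
    · rw [if_pos (show d i.succ ≤ (b i : ℕ) from h), if_pos h]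
      change _ = v (Fin.cons c _)
      rw [Fin.cons_update]
      rfl
    · rw [if_neg (show ¬ d i.succ ≤ (b i : ℕ) from h), if_neg h]
  · simp only [Fin.cons_zero, Fin.update_cons_zero]
    split_ifs <;> rfl

theorem cokerDim_diagOp_succ {n : ℕ} (d : Fin (n + 1) → ℕ) (q a : ℕ) :
    cokerDim (diagOp k d q) a = cokerDim (shiftEnd (diagOp k (Fin.tail d) q) (d 0) q) a :=
  cokerDim_congr (boxConsEquiv k n q) _ _ (boxConsEquiv_diagOp d q) a

/-- Splitting exponents into quotient and remainder modulo `p`. -/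
def boxFrobeniusEquiv (k : Type*) [Field k] (n q p : ℕ) :
    ((Fin n → Fin (q * p)) → k) ≃ₗ[k] ((Fin n → Fin p) → (Fin n → Fin q) → k) where
  toFun v r b := v (fun i => finProdFinEquiv (b i, r i))
  map_add' _ _ := rfl
  map_smul' _ _ := rfl
  invFun w c := w (fun i => (finProdFinEquiv.symm (c i)).2) (fun i => (finProdFinEquiv.symm (c i)).1)
  left_inv v := by
    ext c
    simp only [Prod.mk.eta, Equiv.apply_symm_apply]
  right_inv w := by
    ext r b
    simp only [Equiv.symm_apply_apply]

theorem boxFrobeniusEquiv_diagOp {n : ℕ} (d : Fin n → ℕ) (q p : ℕ)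
    (v : (Fin n → Fin (q * p)) → k) :
    boxFrobeniusEquiv k n q p (diagOp k (fun i => p * d i) (q * p) v) =
      LinearMap.piMap (fun _ => diagOp k d q) (boxFrobeniusEquiv k n q p v) := by
  funext r b
  change diagOp k _ _ v _ = diagOp k d q (boxFrobeniusEquiv k n q p v r) b
  rw [diagOp_apply, diagOp_apply]
  refine Finset.sum_congr rfl fun i _ => ?_
  have hr := (r i).2
  have hiff : p * d i ≤ ((finProdFinEquiv (b i, r i) : Fin (q * p)) : ℕ) ↔ d i ≤ (b i : ℕ) := by
    rw [finProdFinEquiv_apply_val]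
    constructor
    · intro h
      simp only at h
      by_contra! hlt
      have : p * ((b i : ℕ) + 1) ≤ p * d i := Nat.mul_le_mul_left p hlt
      rw [mul_add] at this
      omega
    · intro h
      have := Nat.mul_le_mul_left p h
      simp only
      omega
  by_cases h : d i ≤ (b i : ℕ)
  · rw [if_pos (hiff.2 h), if_pos h]
    change v _ = v _
    congr 1
    funext j
    by_cases hj : j = i
    · subst hj
      rw [Function.update_self, Function.update_self]
      apply Fin.ext
      simp only [finProdFinEquiv_apply_val]
      have := Nat.mul_le_mul_left p h
      rw [Nat.mul_sub]
      omega
    · rw [Function.update_of_ne hj, Function.update_of_ne hj]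
  · rw [if_neg (fun h' => h (hiff.1 h')), if_neg h]

/-- The ring is free over the subring generated by the `x_i^p`, on the `p^n` monomials with
exponents below `p`, and the operator acts on each copy separately. -/
theorem cokerDim_diagOp_frobenius {n : ℕ} (d : Fin n → ℕ) (q p a : ℕ) :
    cokerDim (diagOp k (fun i => p * d i) (q * p)) a = p ^ n * cokerDim (diagOp k d q) a := by
  rw [cokerDim_congr (boxFrobeniusEquiv k n q p) _ _ (boxFrobeniusEquiv_diagOp d q p) a,
    cokerDim_piMap]
  simp

theorem cokerDim_one_eq {V : Type*} [AddCommGroup V] [Module k V] [FiniteDimensional k V]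
    (T : Module.End k V) : cokerDim T 1 = Module.finrank k (LinearMap.ker T) := by
  have h1 := Submodule.finrank_quotient_add_finrank (LinearMap.range T)
  have h2 := LinearMap.finrank_range_add_finrank_ker T
  unfold cokerDim
  rw [pow_one]
  omega

/-- The kernel of `T + y` embeds in `V` through the top coefficient: the equations `T v_{i+1} + v_i
= 0` determine the lower ones. This is the source of the Lipschitz constant. -/
theorem cokerDim_shiftEnd_one_le {V : Type*} [AddCommGroup V] [Module k V] [FiniteDimensional k V]
    (T : Module.End k V) (m : ℕ) : cokerDim (shiftEnd T 1 m) 1 ≤ Module.finrank k V := by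
  rw [cokerDim_one_eq]
  rcases m with _ | m
  · rw [Module.finrank_zero_of_subsingleton]
    exact Nat.zero_le _
  refine LinearMap.finrank_le_finrank_of_injective
    (f := LinearMap.proj (Fin.last m) ∘ₗ (LinearMap.ker (shiftEnd T 1 (m + 1))).subtype) ?_
  rw [← LinearMap.ker_eq_bot, LinearMap.ker_eq_bot']
  rintro ⟨v, hv⟩ h
  rw [LinearMap.mem_ker] at hv
  refine Subtype.ext (funext fun i => ?_)
  change v i = 0
  change v (Fin.last m) = 0 at h
  induction i using Fin.reverseInduction with
  | last => exact h
  | cast i ih =>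
    have e := congrFun hv i.succ
    rw [shiftEnd_apply, ih, map_zero, zero_add, if_pos (by simp)] at e
    exact e

theorem cokerDim_shiftEnd_le {V : Type*} [AddCommGroup V] [Module k V] [FiniteDimensional k V]
    (T : Module.End k V) (d q : ℕ) (hd : 0 < d) :
    cokerDim (shiftEnd T d q) 1 ≤ d * Module.finrank k V := by
  rw [cokerDim_shiftEnd T d q 1 hd]
  refine (Finset.sum_le_sum fun r _ => cokerDim_shiftEnd_one_le T _).trans ?_
  simp

theorem cokerDim_diagOp_one_le {n : ℕ} (d : Fin (n + 1) → ℕ) (q : ℕ) (hd : 0 < d 0) :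
    cokerDim (diagOp k d q) 1 ≤ d 0 * q ^ n := by
  rw [cokerDim_diagOp_succ]
  refine (cokerDim_shiftEnd_le _ _ _ hd).trans ?_
  simp

end Box

/-! ### From power series quotients to the box operator; Frobenius and Lipschitz properties. -/

section PowerSeries

variable {p : ℕ} [Fact p.Prime] {n : ℕ}

/-- An exponent in the box, as a finitely supported function. -/
def boxExp {n q : ℕ} (b : Fin n → Fin q) : Fin n →₀ ℕ :=
  Finsupp.equivFunOnFinite.symm (fun i => (b i : ℕ))

theorem boxExp_apply {q : ℕ} (b : Fin n → Fin q) (i : Fin n) : boxExp b i = b i := rfl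

/-- The coefficients of a power series at the monomials with all exponents less than `q`. -/
def boxCoeff (p : ℕ) [Fact p.Prime] (n q : ℕ) :
    MvPowerSeries (Fin n) (ZMod p) →ₗ[ZMod p] ((Fin n → Fin q) → ZMod p) :=
  LinearMap.pi fun b => MvPowerSeries.coeff (boxExp b)

theorem boxCoeff_apply (q : ℕ) (φ : MvPowerSeries (Fin n) (ZMod p)) (b : Fin n → Fin q) :
    boxCoeff p n q φ b = MvPowerSeries.coeff (boxExp b) φ := rfl

theorem coeff_X_pow_mul_box (i : Fin n) (m : ℕ) (b : Fin n →₀ ℕ)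
    (φ : MvPowerSeries (Fin n) (ZMod p)) :
    MvPowerSeries.coeff b (MvPowerSeries.X i ^ m * φ) =
      if m ≤ b i then MvPowerSeries.coeff (b - Finsupp.single i m) φ else 0 := by
  classical
  rw [MvPowerSeries.X_pow_eq, MvPowerSeries.coeff_monomial_mul, one_mul]
  simp only [Finsupp.single_le_iff]

theorem boxCoeff_diagonal_mul (d : Fin n → ℕ) (q : ℕ) (φ : MvPowerSeries (Fin n) (ZMod p)) :
    boxCoeff p n q (diagonal d p * φ) = diagOp (ZMod p) d q (boxCoeff p n q φ) := by
  funext b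
  rw [boxCoeff_apply, diagOp_apply, diagonal, Finset.sum_mul, map_sum]
  refine Finset.sum_congr rfl fun i _ => ?_
  rw [coeff_X_pow_mul_box]
  rw [boxExp_apply]
  by_cases h : d i ≤ (b i : ℕ)
  · rw [if_pos h, if_pos h, boxCoeff_apply]
    congr 2
    refine Finsupp.ext fun j => ?_
    rw [Finsupp.tsub_apply, boxExp_apply, boxExp_apply]
    by_cases hj : j = i
    · subst hj
      simp
    · rw [Function.update_of_ne hj, Finsupp.single_eq_of_ne hj, tsub_zero]
  · rw [if_neg h, if_neg h]

theorem boxCoeff_diagonal_pow_mul (d : Fin n → ℕ) (q a : ℕ)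
    (φ : MvPowerSeries (Fin n) (ZMod p)) :
    boxCoeff p n q (diagonal d p ^ a * φ) = (diagOp (ZMod p) d q ^ a) (boxCoeff p n q φ) := by
  have h := pow_apply_intertwine (boxCoeff p n q)
    (LinearMap.mulLeft (ZMod p) (diagonal d p)) (diagOp (ZMod p) d q)
    (boxCoeff_diagonal_mul d q) a φ
  rwa [LinearMap.pow_mulLeft] at h

/-- The power series with given coefficients. -/
def seriesOfCoeff (g : (Fin n →₀ ℕ) → ZMod p) : MvPowerSeries (Fin n) (ZMod p) := g

theorem coeff_seriesOfCoeff (g : (Fin n →₀ ℕ) → ZMod p) (b : Fin n →₀ ℕ) :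
    MvPowerSeries.coeff b (seriesOfCoeff g) = g b := rfl

theorem boxCoeff_surjective (q : ℕ) : Function.Surjective (boxCoeff p n q) := by
  intro w
  refine ⟨seriesOfCoeff fun c =>
    if h : ∀ i, c i < q then w (fun i => ⟨c i, h i⟩) else 0, ?_⟩
  funext b
  rw [boxCoeff_apply, coeff_seriesOfCoeff, dif_pos (show ∀ i, boxExp b i < q from fun i => (b i).2)]
  rfl

theorem boxCoeff_eq_zero_iff (q : ℕ) (φ : MvPowerSeries (Fin n) (ZMod p)) :
    boxCoeff p n q φ = 0 ↔
      φ ∈ Ideal.span (Set.range fun i : Fin n =>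
        (MvPowerSeries.X i : MvPowerSeries (Fin n) (ZMod p)) ^ q) := by
  classical
  rw [Ideal.mem_span_range_iff_exists_fun]
  constructor
  · intro h
    -- Each monomial outside the box is charged to the least variable whose exponent is at least
    -- `q`, so it lies in exactly one summand.
    let P : (Fin n →₀ ℕ) → Fin n → Prop := fun b i => q ≤ b i ∧ ∀ j < i, b j < q
    refine ⟨fun i => seriesOfCoeff fun c => if P (c + Finsupp.single i q) i then
      MvPowerSeries.coeff (c + Finsupp.single i q) φ else 0, ?_⟩
    ext b
    rw [map_sum]
    have hterm : ∀ i : Fin n, MvPowerSeries.coeff b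
        (seriesOfCoeff (fun c => if P (c + Finsupp.single i q) i then
          MvPowerSeries.coeff (c + Finsupp.single i q) φ else 0) * MvPowerSeries.X i ^ q) =
        if P b i then MvPowerSeries.coeff b φ else 0 := fun i => by
      rw [mul_comm, coeff_X_pow_mul_box]
      by_cases hi : q ≤ b i
      · rw [if_pos hi, coeff_seriesOfCoeff, tsub_add_cancel_of_le (Finsupp.single_le_iff.2 hi)]
      · rw [if_neg hi, if_neg fun h' => hi h'.1]
    simp only [hterm]
    by_cases hb : ∃ i, q ≤ b i
    · obtain ⟨i, hi, hmin⟩ := WellFounded.has_min (wellFounded_lt (α := Fin n)) {i | q ≤ b i} hb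
      have hPi : P b i := ⟨hi, fun j hj => not_le.1 fun h' => hmin j h' hj⟩
      rw [Finset.sum_eq_single i, if_pos hPi]
      · intro j _ hji
        refine if_neg fun hPj => ?_
        rcases lt_trichotomy i j with hlt | heq | hgt
        · exact absurd hi (not_le.2 (hPj.2 i hlt))
        · exact hji heq.symm
        · exact absurd hPj.1 (not_le.2 (hPi.2 j hgt))
      · simp
    · push Not at hb
      have hb0 := congrFun h (fun i => ⟨b i, hb i⟩)
      rw [boxCoeff_apply] at hb0
      have hbe : boxExp (fun i => (⟨b i, hb i⟩ : Fin q)) = b := by ext i; rfl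
      rw [hbe] at hb0
      simp [hb0]
  · rintro ⟨c, rfl⟩
    funext b
    rw [boxCoeff_apply, map_sum]
    refine Finset.sum_eq_zero fun i _ => ?_
    rw [mul_comm, coeff_X_pow_mul_box, if_neg]
    rw [boxExp_apply]
    exact not_le.2 (b i).2

theorem mem_frobIdeal_iff (d : Fin n → ℕ) (a e : ℕ) (φ : MvPowerSeries (Fin n) (ZMod p)) :
    φ ∈ frobIdeal d p a e ↔
      boxCoeff p n (p ^ e) φ ∈ LinearMap.range (diagOp (ZMod p) d (p ^ e) ^ a) := by
  unfold frobIdeal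
  rw [Ideal.span_union, Submodule.mem_sup]
  constructor
  · rintro ⟨ψ, hψ, χ, hχ, rfl⟩
    rw [← boxCoeff_eq_zero_iff] at hψ
    obtain ⟨c, rfl⟩ := Ideal.mem_span_singleton'.1 hχ
    rw [map_add, hψ, zero_add, mul_comm, boxCoeff_diagonal_pow_mul]
    exact ⟨_, rfl⟩
  · rintro ⟨w, hw⟩
    obtain ⟨c, rfl⟩ := boxCoeff_surjective _ w
    rw [← boxCoeff_diagonal_pow_mul] at hw
    refine ⟨φ - diagonal d p ^ a * c, ?_, diagonal d p ^ a * c, ?_, sub_add_cancel _ _⟩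
    · rw [← boxCoeff_eq_zero_iff, map_sub, hw, sub_self]
    · exact Ideal.mem_span_singleton'.2 ⟨c, mul_comm _ _⟩

theorem finrank_quotient_frobIdeal (d : Fin n → ℕ) (a e : ℕ) :
    Module.finrank (ZMod p) (MvPowerSeries (Fin n) (ZMod p) ⧸ frobIdeal d p a e) =
      cokerDim (diagOp (ZMod p) d (p ^ e)) a := by
  rw [← (Submodule.Quotient.restrictScalarsEquiv (ZMod p) (frobIdeal d p a e)).finrank_eq]
  refine finrank_quotient_of_surjective
    ((LinearMap.range (diagOp (ZMod p) d (p ^ e) ^ a)).mkQ ∘ₗ boxCoeff p n (p ^ e)) ?_ _ ?_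
  · exact (Submodule.mkQ_surjective _).comp (boxCoeff_surjective _)
  · ext φ
    rw [LinearMap.ker_comp, Submodule.ker_mkQ, Submodule.mem_comap,
      Submodule.restrictScalars_mem, mem_frobIdeal_iff]

theorem diagonal_pow_prime (d : Fin n → ℕ) :
    diagonal d p ^ p = diagonal (fun i => p * d i) p := by
  have : CharP (MvPowerSeries (Fin n) (ZMod p)) p :=
    charP_of_injective_algebraMap (algebraMap (ZMod p) (MvPowerSeries (Fin n) (ZMod p))).injective p
  unfold diagonal
  rw [sum_pow_char]
  exact Finset.sum_congr rfl fun i _ => by rw [← pow_mul, mul_comm]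

theorem frobIdeal_prime_mul (d : Fin n → ℕ) (a e : ℕ) :
    frobIdeal d p (p * a) e = frobIdeal (fun i => p * d i) p a e := by
  unfold frobIdeal
  rw [pow_mul, diagonal_pow_prime]

theorem phiValue_eq (d : Fin n → ℕ) (a e : ℕ) :
    phiValue d p a e = (cokerDim (diagOp (ZMod p) d (p ^ e)) a : ℝ) / (p : ℝ) ^ (n * e) := by
  rw [phiValue, finrank_quotient_frobIdeal]

/-- By Frobenius `f^(pa)` is the `a`-th power of the diagonal form with exponents `p * d i`; the
factor `p^n` from freeness cancels against the normalisation. -/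
theorem phiValue_prime_mul (d : Fin n → ℕ) (a e : ℕ) :
    phiValue d p (p * a) (e + 1) = phiValue d p a e := by
  have hp : p.Prime := Fact.out
  have hp0 : (p : ℝ) ≠ 0 := by exact_mod_cast hp.ne_zero
  rw [phiValue_eq d a e, phiValue, frobIdeal_prime_mul, finrank_quotient_frobIdeal, pow_succ,
    cokerDim_diagOp_frobenius, mul_add, mul_one, pow_add]
  push_cast
  field_simp

theorem phiValue_prime_pow_mul (d : Fin n → ℕ) (a e f : ℕ) :
    phiValue d p (p ^ f * a) (e + f) = phiValue d p a e := by
  induction f with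
  | zero => simp
  | succ f ih => rw [pow_succ', mul_assoc, ← add_assoc, phiValue_prime_mul, ih]

theorem phiValue_mono (d : Fin n → ℕ) (e : ℕ) : Monotone fun a => phiValue d p a e := by
  refine monotone_nat_of_le_succ fun a => ?_
  simp only [phiValue_eq]
  gcongr
  exact cokerDim_le_succ _ _

theorem phiValue_succ_le (d : Fin (n + 1) → ℕ) (hd : 0 < d 0) (a e : ℕ) :
    phiValue d p (a + 1) e ≤ phiValue d p a e + d 0 / (p : ℝ) ^ e := by
  have hp : p.Prime := Fact.out
  have hp0 : (0 : ℝ) < p := by exact_mod_cast hp.pos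
  simp only [phiValue_eq]
  have h1 := (cokerDim_succ_le (diagOp (ZMod p) d (p ^ e)) a).trans
    (Nat.add_le_add_left (cokerDim_diagOp_one_le d (p ^ e) hd) _)
  have h2 : (cokerDim (diagOp (ZMod p) d (p ^ e)) (a + 1) : ℝ) ≤
      cokerDim (diagOp (ZMod p) d (p ^ e)) a + d 0 * ((p : ℝ) ^ e) ^ n := by exact_mod_cast h1
  have h3 : (d 0 : ℝ) / (p : ℝ) ^ e = d 0 * ((p : ℝ) ^ e) ^ n / (p : ℝ) ^ ((n + 1) * e) := by
    rw [← pow_mul, add_mul, one_mul, pow_add, mul_comm n e]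
    field_simp
  rw [h3, ← add_div]
  gcongr

theorem phiValue_lipschitz (d : Fin (n + 1) → ℕ) (hd : 0 < d 0) (a b e : ℕ) :
    |phiValue d p a e - phiValue d p b e| ≤ d 0 / (p : ℝ) ^ e * |(a : ℝ) - b| := by
  have key : ∀ a c : ℕ, phiValue d p (a + c) e ≤ phiValue d p a e + c * (d 0 / (p : ℝ) ^ e) := by
    intro a c
    induction c with
    | zero => simp
    | succ c ih =>
      have := phiValue_succ_le (p := p) d hd (a + c) e
      rw [← add_assoc]
      push_cast
      linarith
  wlog hab : b ≤ a generalizing a b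
  · rw [abs_sub_comm, abs_sub_comm (a : ℝ)]
    exact this b a (by omega)
  obtain ⟨c, rfl⟩ := Nat.exists_eq_add_of_le hab
  have h1 := key b c
  have h2 := phiValue_mono (p := p) d e hab
  simp only at h2
  rw [abs_of_nonneg (by linarith)]
  push_cast
  rw [add_sub_cancel_left, Nat.abs_cast]
  linarith

end PowerSeries

/-! ### The profile of the diagonal operator at level `e = 1`. -/

section Profile

/-- The profile of the zero operator on a line. -/
def staircase (x : ℝ) : ℝ := ⌊x / 2⌋ + ⌈x / 2⌉

theorem staircase_neg (x : ℝ) : staircase (-x) = -staircase x := by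
  unfold staircase
  rw [neg_div, Int.floor_neg, Int.ceil_neg]
  push_cast
  ring

theorem staircase_zero : staircase 0 = 0 := by simp [staircase]

theorem staircase_of_mem_Ioo {x : ℝ} (m : ℤ) (h1 : 2 * m < x) (h2 : x < 2 * m + 2) :
    staircase x = 2 * m + 1 := by
  have e1 : ⌊x / 2⌋ = m := by rw [Int.floor_eq_iff]; constructor <;> linarith
  have e2 : ⌈x / 2⌉ = m + 1 := by rw [Int.ceil_eq_iff]; push_cast; constructor <;> linarith
  rw [staircase, e1, e2]
  push_cast
  ring

theorem staircase_two_mul (m : ℤ) : staircase (2 * m) = 2 * m := by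
  rw [staircase, mul_div_cancel_left₀ _ two_ne_zero, Int.floor_intCast, Int.ceil_intCast]
  ring

theorem staircase_one : staircase 1 = 1 := by
  have := staircase_of_mem_Ioo (x := 1) 0 (by simp) (by norm_num)
  simpa using this

theorem staircase_reflect (x : ℝ) : staircase (1 + x) + staircase (1 - x) = 2 * staircase 1 := by
  rw [staircase_one]
  have h : (1 - x) / 2 = 1 - (1 + x) / 2 := by ring
  unfold staircase
  rw [h, sub_eq_add_neg, add_comm (1 : ℝ) (-_), Int.floor_add_one, Int.ceil_add_one, Int.floor_neg,
    Int.ceil_neg]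
  push_cast
  ring

/-- Iterated block sums, one for each exponent. -/
def iterBlockSum (p : ℕ) : ∀ {n : ℕ}, (Fin n → ℕ) → (ℝ → ℝ) → ℝ → ℝ
  | 0, _, g => g
  | _ + 1, d, g => blockSum p (d 0) (iterBlockSum p (Fin.tail d) g)

variable {k : Type*} [Field k]

theorem isProfile_diagOp {p : ℕ} (hp : p.Prime) [CharP k p] {n : ℕ} (d : Fin n → ℕ)
    (hd : ∀ i, 0 < d i) : IsProfile p (diagOp k d p) (iterBlockSum p d staircase) := by
  induction n with
  | zero =>
    have h0 : diagOp k d p = 0 := by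
      refine LinearMap.ext fun v => funext fun b => ?_
      simp [diagOp_apply]
    refine ⟨by rw [h0, zero_pow hp.ne_zero], staircase_neg, staircase_reflect, fun a ha => ?_⟩
    change _ = staircase _
    rcases Nat.eq_zero_or_pos a with rfl | ha0
    · simp [cokerDim_zero, staircase_zero]
    · have hp0 : (0 : ℝ) < p := by exact_mod_cast hp.pos
      have ha0' : (0 : ℝ) < a := by exact_mod_cast ha0
      have ha' : (a : ℝ) ≤ p := by exact_mod_cast ha
      have hle : (a : ℝ) / p ≤ 1 := (div_le_one hp0).2 ha'
      rw [cokerDim_of_pow_eq_zero _ (by rw [h0, zero_pow ha0.ne']),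
        staircase_of_mem_Ioo 0 (by simp; positivity) (by push_cast; linarith)]
      simp
  | succ n ih =>
    have h := (ih (Fin.tail d) fun i => hd i.succ).shiftEnd hp (hd 0)
    refine ⟨?_, h.odd, h.reflect, fun a ha => ?_⟩
    · refine LinearMap.ext fun v => (boxConsEquiv k n p).injective ?_
      rw [pow_apply_intertwine (boxConsEquiv k n p) _ _ (boxConsEquiv_diagOp d p), h.pow_eq_zero]
      simp
    · rw [cokerDim_diagOp_succ]
      exact h.eq_cokerDim a ha

theorem phiValue_one_eq {p : ℕ} [Fact p.Prime] {n : ℕ} (d : Fin n → ℕ) (hd : ∀ i, 0 < d i)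
    {a : ℕ} (ha : a ≤ p) :
    phiValue d p a 1 = iterBlockSum p d staircase (a / p) / (p : ℝ) ^ n := by
  rw [phiValue_eq, pow_one, mul_one, (isProfile_diagOp Fact.out d hd).eq_cokerDim a ha]

end Profile

/-! ### Block sums as Riemann sums for window averages. -/

section Averages

open MeasureTheory intervalIntegral

/-- The average of `g` over the interval of radius `1 / d` around `x`. -/
def windowAvg (d : ℕ) (g : ℝ → ℝ) (x : ℝ) : ℝ :=
  d / 2 * ∫ y in (x - 1 / d)..(x + 1 / d), g y

/-- Iterated window averages, one for each exponent. -/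
def iterWindowAvg : ∀ {n : ℕ}, (Fin n → ℕ) → (ℝ → ℝ) → ℝ → ℝ
  | 0, _, g => g
  | _ + 1, d, g => windowAvg (d 0) (iterWindowAvg (Fin.tail d) g)

theorem abs_integral_le {g : ℝ → ℝ} {B : ℝ} (hB : ∀ x, |g x| ≤ B) (a b : ℝ) :
    |∫ y in a..b, g y| ≤ B * |b - a| :=
  norm_integral_le_of_norm_le_const (f := g) fun x _ => hB x

theorem abs_integral_sub_integral_le {g : ℝ → ℝ} (hg : Monotone g) {B : ℝ} (hB : ∀ x, |g x| ≤ B)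
    (a b a' b' : ℝ) :
    |(∫ y in a..b, g y) - ∫ y in a'..b', g y| ≤ B * (|a' - a| + |b' - b|) := by
  have hi : ∀ a b, IntervalIntegrable g volume a b := fun a b => hg.intervalIntegrable
  rw [integral_interval_sub_interval_comm (hi _ _) (hi _ _) (hi _ _)]
  refine (abs_sub _ _).trans ?_
  have h1 := abs_integral_le hB a a'
  have h2 := abs_integral_le hB b b'
  linarith

theorem abs_windowAvg_le {g : ℝ → ℝ} {B : ℝ} (hB : ∀ x, |g x| ≤ B) {d : ℕ} (hd : 0 < d) (x : ℝ) :
    |windowAvg d g x| ≤ B := by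
  have hd0 : (0 : ℝ) < d := by exact_mod_cast hd
  have h := abs_integral_le hB (x - 1 / d) (x + 1 / d)
  have e : x + 1 / (d : ℝ) - (x - 1 / d) = 2 / d := by ring
  rw [e, abs_of_pos (by positivity : (0 : ℝ) < 2 / d)] at h
  rw [windowAvg, abs_mul, abs_of_pos (by positivity : (0 : ℝ) < d / 2)]
  calc (d : ℝ) / 2 * |∫ y in (x - 1 / d)..(x + 1 / d), g y| ≤ d / 2 * (B * (2 / d)) := by gcongr
    _ = B := by field_simp

theorem windowAvg_mono {g : ℝ → ℝ} (hg : Monotone g) (d : ℕ) : Monotone (windowAvg d g) := by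
  intro x y hxy
  have h : ∀ x, (∫ u in (-(1 / (d : ℝ)))..(1 / d), g (x + u)) =
      ∫ u in (x - 1 / d)..(x + 1 / d), g u := fun x => by
    rw [integral_comp_add_left, ← sub_eq_add_neg]
  unfold windowAvg
  rw [← h, ← h]
  have hm : ∀ x, Monotone fun u => g (x + u) := fun x u v huv => hg (by linarith)
  have hd : (0 : ℝ) ≤ 1 / d := by positivity
  gcongr
  exact integral_mono (by linarith) (hm x).intervalIntegrable (hm y).intervalIntegrable
    fun u => hg (by linarith)

theorem abs_windowAvg_sub_le {g : ℝ → ℝ} (hg : Monotone g) {B : ℝ} (hB : ∀ x, |g x| ≤ B) (d : ℕ)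
    (x y : ℝ) : |windowAvg d g x - windowAvg d g y| ≤ d * B * |x - y| := by
  unfold windowAvg
  rw [← mul_sub, abs_mul, abs_of_nonneg (by positivity)]
  have h := abs_integral_sub_integral_le hg hB (x - 1 / d) (x + 1 / d) (y - 1 / d) (y + 1 / d)
  have e1 : y - 1 / (d : ℝ) - (x - 1 / d) = -(x - y) := by ring
  have e2 : y + 1 / (d : ℝ) - (x + 1 / d) = -(x - y) := by ring
  rw [e1, e2, abs_neg] at h
  calc (d : ℝ) / 2 * _ ≤ d / 2 * (B * (|x - y| + |x - y|)) := by gcongr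
    _ = d * B * |x - y| := by ring

theorem iterWindowAvg_mono {g : ℝ → ℝ} (hg : Monotone g) {n : ℕ} (d : Fin n → ℕ) :
    Monotone (iterWindowAvg d g) := by
  induction n with
  | zero => exact hg
  | succ n ih => exact windowAvg_mono (ih _) _

theorem abs_iterWindowAvg_le {g : ℝ → ℝ} {B : ℝ} (hB : ∀ x, |g x| ≤ B) {n : ℕ} (d : Fin n → ℕ)
    (hd : ∀ i, 0 < d i) (x : ℝ) : |iterWindowAvg d g x| ≤ B := by
  induction n generalizing x with
  | zero => exact hB x
  | succ n ih => exact abs_windowAvg_le (ih (Fin.tail d) fun i => hd i.succ) (hd 0) x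

/-- On each cell of width `2h` the integral and the midpoint term both lie between the end values,
and the errors telescope. Monotonicity replaces continuity because the staircase jumps. -/
theorem abs_sum_sub_integral_le {g : ℝ → ℝ} (hg : Monotone g) {h : ℝ} (hh : 0 ≤ h) (u : ℝ)
    (m : ℕ) :
    |(∑ j ∈ Finset.range m, 2 * h * g (u + (2 * j + 1) * h)) - ∫ y in u..(u + 2 * m * h), g y| ≤
      2 * h * (g (u + 2 * m * h) - g u) := by
  have hi : ∀ a b, IntervalIntegrable g volume a b := fun a b => hg.intervalIntegrable
  induction m with
  | zero => simp
  | succ m ih =>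
    set v := u + 2 * m * h with hv
    have ev : u + 2 * ((m + 1 : ℕ) : ℝ) * h = v + 2 * h := by rw [hv]; push_cast; ring
    have em : u + (2 * (m : ℝ) + 1) * h = v + h := by rw [hv]; ring
    rw [ev, Finset.sum_range_succ, em, ← integral_add_adjacent_intervals (hi u v) (hi v (v + 2 * h))]
    have h1 : 2 * h * g v ≤ ∫ y in v..(v + 2 * h), g y := by
      have := integral_mono_on (a := v) (b := v + 2 * h) (f := fun _ => g v) (g := g) (by linarith)
        intervalIntegrable_const (hi _ _) fun x hx => hg hx.1
      rw [intervalIntegral.integral_const] at this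
      simpa using this
    have h2 : (∫ y in v..(v + 2 * h), g y) ≤ 2 * h * g (v + 2 * h) := by
      have := integral_mono_on (a := v) (b := v + 2 * h) (f := g) (g := fun _ => g (v + 2 * h))
        (by linarith) (hi _ _) intervalIntegrable_const fun x hx => hg hx.2
      rw [intervalIntegral.integral_const] at this
      simpa using this
    have h3 : 2 * h * g v ≤ 2 * h * g (v + h) :=
      mul_le_mul_of_nonneg_left (hg (by linarith)) (by linarith)
    have h4 : 2 * h * g (v + h) ≤ 2 * h * g (v + 2 * h) :=
      mul_le_mul_of_nonneg_left (hg (by linarith)) (by linarith)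
    rw [abs_le] at ih ⊢
    rw [mul_sub] at ih ⊢
    constructor <;> linarith [ih.1, ih.2]

theorem abs_progSum_sub_integral_le {g : ℝ → ℝ} (hg : Monotone g) {B : ℝ} (hB : ∀ x, |g x| ≤ B)
    (p m : ℕ) (x : ℝ) :
    |progSum p m g x / p - 1 / 2 * ∫ y in (x - m / p)..(x + m / p), g y| ≤ 2 * B / p := by
  have h := abs_sum_sub_integral_le hg (h := 1 / p) (by positivity) (x - m / p) m
  have e1 : x - (m : ℝ) / p + 2 * m * (1 / p) = x + m / p := by ring
  have e2 : ∑ j ∈ Finset.range m, 2 * (1 / (p : ℝ)) * g (x - m / p + (2 * j + 1) * (1 / p)) =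
      2 * (progSum p m g x / p) := by
    unfold progSum
    rw [← Finset.sum_range_reflect, Finset.sum_div, Finset.mul_sum]
    refine Finset.sum_congr rfl fun j hj => ?_
    rw [Finset.mem_range] at hj
    have e : x - (m : ℝ) / p + (2 * ((m - 1 - j : ℕ) : ℝ) + 1) * (1 / p) =
        x + (m - 1 - 2 * j) / p := by
      rw [Nat.sub_sub, Nat.cast_sub (by omega)]
      push_cast
      ring
    rw [e]
    ring
  rw [e1, e2] at h
  have h1 := abs_le.1 (hB (x + m / p))
  have h2 := abs_le.1 (hB (x - m / p))
  have h3 : 2 * (1 / (p : ℝ)) * (g (x + m / p) - g (x - m / p)) ≤ 2 * (1 / p) * (2 * B) := by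
    gcongr
    linarith
  have e3 : 2 * (1 / (p : ℝ)) * (2 * B) = 2 * (2 * B / p) := by ring
  rw [e3] at h3
  rw [abs_le] at h ⊢
  constructor <;> linarith [h.1, h.2]

theorem abs_blockLength_div_sub_le {p d r : ℕ} (hp : 0 < p) (hr : r < d) :
    |(blockLength p d r : ℝ) / p - 1 / d| ≤ 1 / p := by
  have hp0 : (0 : ℝ) < p := by exact_mod_cast hp
  have hd0 : (0 : ℝ) < d := by exact_mod_cast (by omega : 0 < d)
  have h1 : d * blockLength p d r ≤ p + d := by
    have := Nat.mul_div_le (p + (d - 1 - r)) d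
    unfold blockLength
    omega
  have h2 : p ≤ d * blockLength p d r + d := by
    have := Nat.lt_mul_div_succ (p + (d - 1 - r)) (by omega : 0 < d)
    unfold blockLength
    rw [mul_add] at this
    omega
  have h1' : (d : ℝ) * blockLength p d r ≤ p + d := by exact_mod_cast h1
  have h2' : (p : ℝ) ≤ d * blockLength p d r + d := by exact_mod_cast h2
  have e : (blockLength p d r : ℝ) / p - 1 / d = (d * blockLength p d r - p) / (d * p) := by
    field_simp
  have e' : 1 / (p : ℝ) = d / (d * p) := by field_simp
  rw [e, e', abs_div, abs_of_pos (by positivity : (0 : ℝ) < d * p)]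
  gcongr
  rw [abs_le]
  constructor <;> linarith

/-- Each of the `d` blocks costs `2B/p` for the Riemann sum and `B/p` for replacing its radius `m/p`
by `1/d`. -/
theorem abs_blockSum_sub_windowAvg_le {g : ℝ → ℝ} (hg : Monotone g) {B : ℝ} (hB : ∀ x, |g x| ≤ B)
    {p : ℕ} (hp : 0 < p) (d : ℕ) (x : ℝ) :
    |blockSum p d g x / p - windowAvg d g x| ≤ 3 * d * B / p := by
  have hB0 : 0 ≤ B := (abs_nonneg _).trans (hB 0)
  have key : ∀ r : Fin d, |progSum p (blockLength p d r) g x / p -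
      1 / 2 * ∫ y in (x - 1 / d)..(x + 1 / d), g y| ≤ 3 * B / p := fun r => by
    have h1 := abs_progSum_sub_integral_le hg hB p (blockLength p d r) x
    have h2 := abs_integral_sub_integral_le hg hB (x - blockLength p d r / p)
      (x + blockLength p d r / p) (x - 1 / d) (x + 1 / d)
    have h3 := abs_blockLength_div_sub_le hp r.2
    have e1 : x - 1 / (d : ℝ) - (x - blockLength p d r / p) = blockLength p d r / p - 1 / d := by
      ring
    have e2 : x + 1 / (d : ℝ) - (x + blockLength p d r / p) = -(blockLength p d r / p - 1 / d) := by
      ring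
    rw [e1, e2, abs_neg] at h2
    have h4 := h2.trans (mul_le_mul_of_nonneg_left (add_le_add h3 h3) hB0)
    have e3 : B * (1 / (p : ℝ) + 1 / p) = 2 * (B / p) := by ring
    have e4 : 2 * B / (p : ℝ) = 2 * (B / p) := by ring
    have e5 : 3 * B / (p : ℝ) = 3 * (B / p) := by ring
    rw [e3] at h4
    rw [e4] at h1
    rw [e5]
    rw [abs_le] at h1 h4 ⊢
    constructor <;> linarith [h1.1, h1.2, h4.1, h4.2]
  have e : blockSum p d g x / p - windowAvg d g x =
      ∑ r : Fin d, (progSum p (blockLength p d r) g x / p -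
        1 / 2 * ∫ y in (x - 1 / d)..(x + 1 / d), g y) := by
    rw [Finset.sum_sub_distrib, ← Finset.sum_div, Finset.sum_const, Finset.card_univ,
      Fintype.card_fin, nsmul_eq_mul, blockSum, windowAvg]
    ring
  rw [e]
  refine (Finset.abs_sum_le_sum_abs _ _).trans ((Finset.sum_le_sum fun r _ => key r).trans ?_)
  rw [Finset.sum_const, Finset.card_univ, Fintype.card_fin, nsmul_eq_mul]
  exact le_of_eq (by ring)

theorem abs_blockSum_sub_blockSum_le {p : ℕ} (hp : 0 < p) (d : ℕ) {g g' : ℝ → ℝ} {δ : ℝ}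
    (h : ∀ x, |g x - g' x| ≤ δ) (x : ℝ) :
    |blockSum p d g x / p - blockSum p d g' x / p| ≤ d * δ := by
  have hp0 : (0 : ℝ) < p := by exact_mod_cast hp
  have hδ : 0 ≤ δ := (abs_nonneg _).trans (h 0)
  have key : ∀ r : Fin d, |progSum p (blockLength p d r) g x -
      progSum p (blockLength p d r) g' x| ≤ p * δ := fun r => by
    unfold progSum
    rw [← Finset.sum_sub_distrib]
    refine (Finset.abs_sum_le_sum_abs _ _).trans ((Finset.sum_le_sum fun j _ => h _).trans ?_)
    rw [Finset.sum_const, Finset.card_range, nsmul_eq_mul]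
    gcongr
    exact blockLength_le r.2
  rw [← sub_div, abs_div, abs_of_pos hp0, div_le_iff₀ hp0]
  unfold blockSum
  rw [← Finset.sum_sub_distrib]
  refine (Finset.abs_sum_le_sum_abs _ _).trans ((Finset.sum_le_sum fun r _ => key r).trans ?_)
  rw [Finset.sum_const, Finset.card_univ, Fintype.card_fin, nsmul_eq_mul]
  exact le_of_eq (by ring)

theorem blockSum_div (p d : ℕ) (g : ℝ → ℝ) (c x : ℝ) :
    blockSum p d (fun y => g y / c) x = blockSum p d g x / c := by
  simp only [blockSum, progSum, Finset.sum_div]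

theorem exists_abs_iterBlockSum_sub_le {g : ℝ → ℝ} (hg : Monotone g) {B : ℝ}
    (hB : ∀ x, |g x| ≤ B) {n : ℕ} (d : Fin n → ℕ) (hd : ∀ i, 0 < d i) :
    ∃ c : ℝ, ∀ p : ℕ, 0 < p → ∀ x,
      |iterBlockSum p d g x / (p : ℝ) ^ n - iterWindowAvg d g x| ≤ c / p := by
  induction n with
  | zero => exact ⟨0, fun p _ x => by simp [iterBlockSum, iterWindowAvg]⟩
  | succ n ih =>
    obtain ⟨c, hc⟩ := ih (Fin.tail d) fun i => hd i.succ
    refine ⟨d 0 * c + 3 * d 0 * B, fun p hp x => ?_⟩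
    have h1 := abs_blockSum_sub_blockSum_le hp (d 0) (hc p hp) x
    have h2 := abs_blockSum_sub_windowAvg_le (iterWindowAvg_mono hg (Fin.tail d))
      (abs_iterWindowAvg_le hB (Fin.tail d) fun i => hd i.succ) hp (d 0) x
    rw [blockSum_div, div_div, ← pow_succ] at h1
    change |blockSum p (d 0) (iterBlockSum p (Fin.tail d) g) x / (p : ℝ) ^ (n + 1) -
      windowAvg (d 0) (iterWindowAvg (Fin.tail d) g) x| ≤ _
    refine (abs_sub_le _ _ _).trans ((add_le_add h1 h2).trans (le_of_eq ?_))
    ring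

theorem abs_iterWindowAvg_sub_le {g : ℝ → ℝ} (hg : Monotone g) {B : ℝ} (hB : ∀ x, |g x| ≤ B)
    {n : ℕ} (d : Fin (n + 1) → ℕ) (hd : ∀ i, 0 < d i) (x y : ℝ) :
    |iterWindowAvg d g x - iterWindowAvg d g y| ≤ d 0 * B * |x - y| :=
  abs_windowAvg_sub_le (iterWindowAvg_mono hg (Fin.tail d))
    (abs_iterWindowAvg_le hB (Fin.tail d) fun i => hd i.succ) (d 0) x y

/-- Each block sum looks at distance at most `1`, so `n` of them see `g` only on `|x| ≤ K + n`. The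
unbounded staircase may therefore be replaced by a bounded function. -/
theorem iterBlockSum_congr {p : ℕ} (hp : 0 < p) {g g' : ℝ → ℝ} {n : ℕ} (d : Fin n → ℕ) {K : ℝ}
    (h : ∀ x, |x| ≤ K + n → g x = g' x) (x : ℝ) (hx : |x| ≤ K) :
    iterBlockSum p d g x = iterBlockSum p d g' x := by
  have hp0 : (0 : ℝ) < p := by exact_mod_cast hp
  induction n generalizing K x with
  | zero => exact h x (by simpa using hx)
  | succ n ih =>
    change blockSum p (d 0) _ x = blockSum p (d 0) _ x
    unfold blockSum progSum
    refine Finset.sum_congr rfl fun r _ => Finset.sum_congr rfl fun j hj => ?_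
    refine ih (Fin.tail d) (K := K + 1) (fun y hy => h y ?_) _ ?_
    · push_cast
      linarith
    · have h1 : ((blockLength p (d 0) r : ℕ) : ℝ) ≤ p := by exact_mod_cast blockLength_le r.2
      have h2 : (j : ℝ) + 1 ≤ (blockLength p (d 0) r : ℕ) := by
        exact_mod_cast Finset.mem_range.1 hj
      have h3 : (0 : ℝ) ≤ j := Nat.cast_nonneg j
      have h4 : |((blockLength p (d 0) r : ℝ) - 1 - 2 * j) / p| ≤ 1 := by
        rw [abs_div, abs_of_pos hp0, div_le_one hp0, abs_le]
        constructor <;> linarith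
      exact (abs_add_le _ _).trans (add_le_add hx h4)

end Averages

/-! ### Truncated powers, and the formula for the limit as an iterated average. -/

section TruncatedPowers

open MeasureTheory intervalIntegral

/-- The Heaviside function with value `1 / 2` at `0`. -/
def heaviside (x : ℝ) : ℝ := if x < 0 then 0 else if x = 0 then 1 / 2 else 1

theorem heaviside_of_neg {x : ℝ} (h : x < 0) : heaviside x = 0 := if_pos h

theorem heaviside_zero : heaviside 0 = 1 / 2 := by simp [heaviside]

theorem heaviside_of_pos {x : ℝ} (h : 0 < x) : heaviside x = 1 := by
  rw [heaviside, if_neg h.le.not_gt, if_neg h.ne']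

theorem heaviside_mono : Monotone heaviside := by
  intro x y h
  unfold heaviside
  split_ifs <;> first | norm_num; done | grind

theorem abs_heaviside_le (x : ℝ) : |heaviside x| ≤ 1 := by
  unfold heaviside
  split_ifs <;> norm_num [abs_le]

/-- The truncated powers `max(x, 0)^k / k!`, each an antiderivative of the preceding one. -/
def truncPow : ℕ → ℝ → ℝ
  | 0, x => heaviside x
  | k + 1, x => max x 0 ^ (k + 1) / (k + 1).factorial

theorem truncPow_of_neg (k : ℕ) {x : ℝ} (h : x < 0) : truncPow k x = 0 := by
  cases k with
  | zero => exact heaviside_of_neg h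
  | succ k => simp [truncPow, max_eq_right h.le]

theorem truncPow_of_pos (k : ℕ) {x : ℝ} (h : 0 < x) : truncPow k x = x ^ k / k.factorial := by
  cases k with
  | zero =>
    rw [pow_zero, Nat.factorial_zero, Nat.cast_one, div_one]
    exact heaviside_of_pos h
  | succ k => simp [truncPow, max_eq_left h.le]

theorem truncPow_mono (k : ℕ) : Monotone (truncPow k) := by
  cases k with
  | zero => exact heaviside_mono
  | succ k =>
    intro x y h
    change max x 0 ^ (k + 1) / ((k + 1).factorial : ℝ) ≤ max y 0 ^ (k + 1) / (k + 1).factorial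
    have : (0 : ℝ) ≤ max x 0 := le_max_right _ _
    gcongr

theorem continuous_truncPow_succ (k : ℕ) : Continuous (truncPow (k + 1)) := by
  unfold truncPow
  fun_prop

theorem hasDerivAt_truncPow_succ (k : ℕ) {x : ℝ} (hx : x ≠ 0) :
    HasDerivAt (truncPow (k + 1)) (truncPow k x) x := by
  rcases lt_or_gt_of_ne hx with h | h
  · rw [truncPow_of_neg k h]
    refine (hasDerivAt_const x (0 : ℝ)).congr_of_eventuallyEq ?_
    filter_upwards [gt_mem_nhds h] with y hy
    exact truncPow_of_neg _ hy
  · rw [truncPow_of_pos k h]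
    have h1 : HasDerivAt (fun y : ℝ => y ^ (k + 1) / ((k + 1).factorial : ℝ))
        (x ^ k / k.factorial) x := by
      refine ((hasDerivAt_pow (k + 1) x).div_const _).congr_deriv ?_
      rw [Nat.factorial_succ]
      push_cast
      field_simp
    refine h1.congr_of_eventuallyEq ?_
    filter_upwards [lt_mem_nhds h] with y hy
    exact truncPow_of_pos _ hy

theorem integral_truncPow (k : ℕ) (a b : ℝ) :
    ∫ y in a..b, truncPow k y = truncPow (k + 1) b - truncPow (k + 1) a :=
  integral_eq_of_hasDerivAt_off_countable _ _ (Set.countable_singleton (0 : ℝ))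
    (continuous_truncPow_succ k).continuousOn (fun _ hx => hasDerivAt_truncPow_succ k hx.2)
    (truncPow_mono k).intervalIntegrable

/-- The weight `1` for `l = 0` and `2` for `l ≥ 1`. -/
def reflWeight (l : ℕ) : ℝ := if l = 0 then 1 else 2

theorem reflWeight_nonneg (l : ℕ) : 0 ≤ reflWeight l := by
  unfold reflWeight
  split_ifs <;> norm_num

/-- The odd or even extension of the truncated power with knot `2 l`. -/
def knotTerm (k l : ℕ) (x : ℝ) : ℝ :=
  truncPow k (x - 2 * l) - (-1) ^ k * truncPow k (-x - 2 * l)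

/-- The `k`-fold antiderivative of the staircase function, truncated to `L` knots. -/
def knotSum (L k : ℕ) (x : ℝ) : ℝ := ∑ l ∈ Finset.range L, reflWeight l * knotTerm k l x

theorem knotTerm_zero_mono (l : ℕ) : Monotone (knotTerm 0 l) := by
  intro x y h
  unfold knotTerm
  have h1 := truncPow_mono 0 (show x - 2 * (l : ℝ) ≤ y - 2 * l by linarith)
  have h2 := truncPow_mono 0 (show -y - 2 * (l : ℝ) ≤ -x - 2 * l by linarith)
  rw [pow_zero]
  linarith

theorem knotSum_zero_mono (L : ℕ) : Monotone (knotSum L 0) := fun _ _ h =>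
  Finset.sum_le_sum fun l _ => mul_le_mul_of_nonneg_left (knotTerm_zero_mono l h)
    (reflWeight_nonneg l)

theorem abs_knotSum_zero_le (L : ℕ) (x : ℝ) :
    |knotSum L 0 x| ≤ ∑ l ∈ Finset.range L, reflWeight l * 2 := by
  refine (Finset.abs_sum_le_sum_abs _ _).trans (Finset.sum_le_sum fun l _ => ?_)
  rw [abs_mul, abs_of_nonneg (reflWeight_nonneg l)]
  refine mul_le_mul_of_nonneg_left ?_ (reflWeight_nonneg l)
  rw [knotTerm, pow_zero, one_mul]
  refine (abs_sub _ _).trans ?_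
  have h1 := abs_heaviside_le (x - 2 * l)
  have h2 := abs_heaviside_le (-x - 2 * l)
  change |heaviside _| + |heaviside _| ≤ 2
  linarith

theorem knotTerm_intervalIntegrable (k l : ℕ) (a b : ℝ) :
    IntervalIntegrable (knotTerm k l) volume a b := by
  have h1 : Monotone fun x : ℝ => truncPow k (x - 2 * l) := fun x y h =>
    truncPow_mono k (by linarith)
  have h2 : Antitone fun x : ℝ => truncPow k (-x - 2 * l) := fun x y h =>
    truncPow_mono k (by linarith)
  exact h1.intervalIntegrable.sub (h2.intervalIntegrable.const_mul _)

theorem integral_knotTerm (k l : ℕ) (a b : ℝ) :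
    ∫ y in a..b, knotTerm k l y = knotTerm (k + 1) l b - knotTerm (k + 1) l a := by
  have h1 : Monotone fun x : ℝ => truncPow k (x - 2 * l) := fun x y h =>
    truncPow_mono k (by linarith)
  have h2 : Antitone fun x : ℝ => truncPow k (-x - 2 * l) := fun x y h =>
    truncPow_mono k (by linarith)
  have e : ∫ y in a..b, truncPow k (-y - 2 * l) =
      truncPow (k + 1) (-a - 2 * l) - truncPow (k + 1) (-b - 2 * l) := by
    rw [← integral_truncPow,
      intervalIntegral.integral_comp_neg (fun y => truncPow k (y - 2 * l)),
      integral_comp_sub_right]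
  unfold knotTerm
  rw [intervalIntegral.integral_sub h1.intervalIntegrable (h2.intervalIntegrable.const_mul _),
    intervalIntegral.integral_const_mul, e, integral_comp_sub_right, integral_truncPow]
  ring

theorem knotSum_intervalIntegrable (L k : ℕ) (a b : ℝ) :
    IntervalIntegrable (knotSum L k) volume a b := by
  have := IntervalIntegrable.sum (μ := volume) (a := a) (b := b) (Finset.range L)
    (f := fun l x => reflWeight l * knotTerm k l x)
    fun l _ => (knotTerm_intervalIntegrable k l a b).const_mul _
  refine this.congr fun x _ => ?_
  simp [knotSum]

theorem integral_knotSum (L k : ℕ) (a b : ℝ) :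
    ∫ y in a..b, knotSum L k y = knotSum L (k + 1) b - knotSum L (k + 1) a := by
  unfold knotSum
  rw [intervalIntegral.integral_finsetSum
    fun l _ => (knotTerm_intervalIntegrable k l a b).const_mul _, ← Finset.sum_sub_distrib]
  refine Finset.sum_congr rfl fun l _ => ?_
  rw [intervalIntegral.integral_const_mul, integral_knotTerm, mul_sub]

theorem sum_fin_succ_units {n : ℕ} (F : (Fin (n + 1) → ℤˣ) → ℝ) :
    ∑ ε, F ε = ∑ ε : Fin n → ℤˣ, (F (Fin.cons 1 ε) + F (Fin.cons (-1) ε)) := by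
  rw [← (Fin.consEquiv fun _ : Fin (n + 1) => ℤˣ).sum_comp, Fintype.sum_prod_type,
    Finset.sum_add_distrib]
  have : (Finset.univ : Finset ℤˣ) = {1, -1} := by decide
  rw [this, Finset.sum_pair (by decide)]
  rfl

/-- Each average is `d/2` times the difference of an antiderivative at `x ± 1/d`; iterating produces
the signed sum. -/
theorem iterWindowAvg_eq {G : ℕ → ℝ → ℝ} (hG : ∀ k a b, IntervalIntegrable (G k) volume a b)
    (hG' : ∀ k a b, ∫ y in a..b, G k y = G (k + 1) b - G (k + 1) a) {n : ℕ} (d : Fin n → ℕ)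
    (x : ℝ) :
    iterWindowAvg d (G 0) x = (∏ i, (d i : ℝ)) / 2 ^ n *
      ∑ ε : Fin n → ℤˣ, (∏ i, ((ε i : ℤ) : ℝ)) * G n (x + ∑ i, ((ε i : ℤ) : ℝ) / d i) := by
  induction n generalizing x with
  | zero => simp [iterWindowAvg]
  | succ n ih =>
    change windowAvg (d 0) (iterWindowAvg (Fin.tail d) (G 0)) x = _
    rw [windowAvg, funext (ih (Fin.tail d)), sum_fin_succ_units, intervalIntegral.integral_const_mul]
    have hi : ∀ ε : Fin n → ℤˣ, IntervalIntegrable (fun y => (∏ i, ((ε i : ℤ) : ℝ)) *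
        G n (y + ∑ i, ((ε i : ℤ) : ℝ) / Fin.tail d i)) volume (x - 1 / d 0) (x + 1 / d 0) :=
      fun ε => by
        have := (hG n (x - 1 / d 0 + ∑ i, ((ε i : ℤ) : ℝ) / Fin.tail d i)
          (x + 1 / d 0 + ∑ i, ((ε i : ℤ) : ℝ) / Fin.tail d i)).comp_add_right
            (∑ i, ((ε i : ℤ) : ℝ) / Fin.tail d i)
        simp only [add_sub_cancel_right] at this
        exact this.const_mul _
    rw [intervalIntegral.integral_finsetSum fun ε _ => hi ε, Fin.prod_univ_succ, pow_succ]
    have e : (d 0 : ℝ) / 2 * ((∏ i, (Fin.tail d i : ℝ)) / 2 ^ n * ∑ ε : Fin n → ℤˣ,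
        ∫ y in (x - 1 / d 0)..(x + 1 / d 0), (∏ i, ((ε i : ℤ) : ℝ)) *
          G n (y + ∑ i, ((ε i : ℤ) : ℝ) / Fin.tail d i)) =
        ((d 0 : ℝ) * ∏ i : Fin n, (d i.succ : ℝ)) / (2 ^ n * 2) * ∑ ε : Fin n → ℤˣ,
        ∫ y in (x - 1 / d 0)..(x + 1 / d 0), (∏ i, ((ε i : ℤ) : ℝ)) *
          G n (y + ∑ i, ((ε i : ℤ) : ℝ) / Fin.tail d i) := by
      rw [← mul_assoc]
      congr 1
      change (d 0 : ℝ) / 2 * ((∏ i : Fin n, (d i.succ : ℝ)) / 2 ^ n) = _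
      ring
    rw [e]
    congr 1
    refine Finset.sum_congr rfl fun ε _ => ?_
    rw [intervalIntegral.integral_const_mul, intervalIntegral.integral_comp_add_right (G n), hG']
    simp only [Fin.prod_univ_succ, Fin.sum_univ_succ, Fin.cons_zero, Fin.cons_succ, Units.val_one,
      Units.val_neg, Int.cast_one, Int.cast_neg, one_mul, neg_mul, mul_sub]
    change _ * G (n + 1) (_ + ∑ i : Fin n, ((ε i : ℤ) : ℝ) / d i.succ) -
      _ * G (n + 1) (_ + ∑ i : Fin n, ((ε i : ℤ) : ℝ) / d i.succ) = _
    rw [sub_eq_add_neg]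
    congr 3
    · ring_nf
    · congr 1
      ring

theorem signForm_cons {n : ℕ} (d : Fin n → ℕ) (l : ℕ) (s : ℤˣ) (ε : Fin n → ℤˣ) (t : ℝ) :
    signForm d l (Fin.cons s ε) t =
      ((s : ℤ) : ℝ) * t + ∑ i, ((ε i : ℤ) : ℝ) / d i - 2 * l := by
  simp [signForm]

/-- For `n ≥ 1` a vanishing form contributes nothing on either side; for `n = 0` the value `1/2` of
`heaviside` at `0` would spoil this. -/
theorem C_eq_sum_truncPow {n : ℕ} (hn : 1 ≤ n) (d : Fin n → ℕ) (l : ℕ) (t : ℝ) :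
    C d l t = n.factorial * ∑ ε : Fin (n + 1) → ℤˣ,
      (∏ j, ((ε j : ℤ) : ℝ)) * truncPow n (signForm d l ε t) := by
  obtain ⟨m, rfl⟩ : ∃ m, n = m + 1 := ⟨n - 1, by omega⟩
  rw [C, Finset.sum_filter, Finset.mul_sum]
  refine Finset.sum_congr rfl fun ε _ => ?_
  have hf : ((m + 1).factorial : ℝ) ≠ 0 := by positivity
  change _ = _ * (_ * (max _ 0 ^ (m + 1) / _))
  split_ifs with h
  · rw [max_eq_left h]
    field_simp
  · rw [max_eq_right (not_le.1 h).le]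
    simp

/-- A term with `ε_0 = 1` is paired with the one obtained by flipping every sign: the form becomes
`-(t + ⋯) - 2l`, and the sign product gains `-(-1)^n`. -/
theorem C_eq_sum_knotTerm {n : ℕ} (hn : 1 ≤ n) (d : Fin n → ℕ) (l : ℕ) (t : ℝ) :
    C d l t = n.factorial * ∑ ε : Fin n → ℤˣ,
      (∏ i, ((ε i : ℤ) : ℝ)) * knotTerm n l (t + ∑ i, ((ε i : ℤ) : ℝ) / d i) := by
  rw [C_eq_sum_truncPow hn, sum_fin_succ_units, Finset.sum_add_distrib]
  congr 1
  rw [← Equiv.sum_comp (Equiv.neg (Fin n → ℤˣ))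
    (fun ε => (∏ j, (((Fin.cons (-1) ε : Fin (n + 1) → ℤˣ) j : ℤ) : ℝ)) *
      truncPow n (signForm d l (Fin.cons (-1) ε) t)), ← Finset.sum_add_distrib]
  refine Finset.sum_congr rfl fun ε _ => ?_
  have hprod : ∏ i, (((-ε) i : ℤ) : ℝ) = (-1) ^ n * ∏ i, ((ε i : ℤ) : ℝ) := by
    simp [Finset.prod_neg]
  have hsum : ∑ i, (((-ε) i : ℤ) : ℝ) / d i = -∑ i, ((ε i : ℤ) : ℝ) / d i := by
    rw [← Finset.sum_neg_distrib]
    exact Finset.sum_congr rfl fun i _ => by simp [neg_div]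
  simp only [signForm_cons, Fin.prod_univ_succ, Fin.cons_zero, Fin.cons_succ, Equiv.neg_apply]
  rw [hprod, hsum, knotTerm]
  have e1 : (((1 : ℤˣ) : ℤ) : ℝ) * t + ∑ i, ((ε i : ℤ) : ℝ) / d i - 2 * l =
    t + ∑ i, ((ε i : ℤ) : ℝ) / d i - 2 * l := by simp
  have e2 : (((-1 : ℤˣ) : ℤ) : ℝ) * t + -∑ i, ((ε i : ℤ) : ℝ) / d i - 2 * l =
    -(t + ∑ i, ((ε i : ℤ) : ℝ) / d i) - 2 * l := by simp; ring
  rw [e1, e2]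
  simp only [Units.val_one, Units.val_neg, Int.cast_one, Int.cast_neg]
  ring

theorem signForm_neg_of_lt {n : ℕ} (d : Fin n → ℕ) {l : ℕ} (hl : n < l) (ε : Fin (n + 1) → ℤˣ)
    {t : ℝ} (ht : t ∈ Icc (0 : ℝ) 1) : signForm d l ε t < 0 := by
  have hs : ∀ s : ℤˣ, ((s : ℤ) : ℝ) ≤ 1 := fun s => by
    rcases Int.units_eq_one_or s with rfl | rfl <;> simp
  have h1 : ((ε 0 : ℤ) : ℝ) * t ≤ 1 :=
    (mul_le_of_le_one_left ht.1 (hs _)).trans ht.2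
  have h2 : ∑ i : Fin n, ((ε i.succ : ℤ) : ℝ) / (d i : ℝ) ≤ n := by
    have : ∀ i : Fin n, ((ε i.succ : ℤ) : ℝ) / (d i : ℝ) ≤ 1 := fun i => by
      rcases Nat.eq_zero_or_pos (d i) with h | h
      · simp [h]
      · have h' : (1 : ℝ) ≤ d i := by exact_mod_cast h
        rw [div_le_one (by linarith)]
        exact (hs _).trans h'
    refine (Finset.sum_le_sum fun i _ => this i).trans ?_
    simp
  have h3 : (n : ℝ) + 1 ≤ l := by exact_mod_cast hl
  have h4 : (0 : ℝ) ≤ n := Nat.cast_nonneg n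
  unfold signForm
  linarith

theorem C_eq_zero_of_lt {n : ℕ} (d : Fin n → ℕ) {l : ℕ} (hl : n < l) {t : ℝ}
    (ht : t ∈ Icc (0 : ℝ) 1) : C d l t = 0 := by
  unfold C
  rw [Finset.filter_false_of_mem, Finset.sum_empty]
  exact fun ε _ => not_le.2 (signForm_neg_of_lt d hl ε ht)

theorem phiLimit_eq_sum {n : ℕ} (d : Fin n → ℕ) {t : ℝ} (ht : t ∈ Icc (0 : ℝ) 1) :
    phiLimit d t = (∏ i, (d i : ℝ)) / (2 ^ n * (n.factorial : ℝ)) *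
      ∑ l ∈ Finset.range (n + 1), reflWeight l * C d l t := by
  rw [phiLimit, tsum_eq_sum (s := Finset.range n), Finset.sum_range_succ', Finset.mul_sum, add_comm]
  · simp [reflWeight]
  · intro l hl
    rw [Finset.mem_range, not_lt] at hl
    exact C_eq_zero_of_lt d (by omega) ht

theorem phiLimit_eq_iterWindowAvg {n : ℕ} (hn : 1 ≤ n) (d : Fin n → ℕ) {t : ℝ}
    (ht : t ∈ Icc (0 : ℝ) 1) : phiLimit d t = iterWindowAvg d (knotSum (n + 1) 0) t := by
  rw [phiLimit_eq_sum d ht,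
    iterWindowAvg_eq (knotSum_intervalIntegrable (n + 1)) (integral_knotSum (n + 1))]
  have hf : (n.factorial : ℝ) ≠ 0 := by positivity
  have e : ∑ ε : Fin n → ℤˣ, (∏ i, ((ε i : ℤ) : ℝ)) *
      knotSum (n + 1) n (t + ∑ i, ((ε i : ℤ) : ℝ) / d i) =
      (∑ l ∈ Finset.range (n + 1), reflWeight l * C d l t) / n.factorial := by
    rw [eq_div_iff hf]
    simp only [C_eq_sum_knotTerm hn, knotSum, Finset.mul_sum, Finset.sum_mul]
    rw [Finset.sum_comm]
    refine Finset.sum_congr rfl fun l _ => Finset.sum_congr rfl fun ε _ => ?_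
    ring
  rw [e]
  field_simp

theorem knotSum_zero_neg (L : ℕ) (x : ℝ) : knotSum L 0 (-x) = -knotSum L 0 x := by
  unfold knotSum
  rw [← Finset.sum_neg_distrib]
  refine Finset.sum_congr rfl fun l _ => ?_
  simp only [knotTerm, neg_neg]
  ring

theorem knotTerm_zero_eq (l : ℕ) {x : ℝ} (hx : 0 < x) :
    knotTerm 0 l x = heaviside (x - 2 * l) := by
  have hl : (0 : ℝ) ≤ l := Nat.cast_nonneg l
  rw [knotTerm, truncPow_of_neg 0 (by linarith : -x - 2 * (l : ℝ) < 0), mul_zero, sub_zero]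
  rfl

theorem knotSum_zero_of_pos (L : ℕ) {x : ℝ} (hx : 0 < x) :
    (x < 2 * (L + 1) → knotSum (L + 1) 0 x = staircase x) ∧
      (2 * (L + 1) ≤ x → knotSum (L + 1) 0 x = 2 * L + 1) := by
  induction L with
  | zero =>
    have h : knotSum (0 + 1) 0 x = 1 := by
      rw [knotSum, zero_add, Finset.sum_range_one, knotTerm_zero_eq 0 hx,
        heaviside_of_pos (by simpa using hx), reflWeight, if_pos rfl, one_mul]
    rw [h]
    refine ⟨fun h' => ?_, fun _ => by simp⟩
    rw [staircase_of_mem_Ioo 0 (by simpa using hx) (by push_cast at h' ⊢; linarith)]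
    simp
  | succ L ih =>
    have h : knotSum (L + 1 + 1) 0 x =
        knotSum (L + 1) 0 x + 2 * heaviside (x - 2 * (L + 1 : ℕ)) := by
      rw [knotSum, Finset.sum_range_succ, knotTerm_zero_eq _ hx, reflWeight,
        if_neg (Nat.succ_ne_zero L), knotSum]
    rw [h]
    push_cast
    rcases lt_trichotomy x (2 * (L + 1)) with hlt | heq | hgt
    · rw [heaviside_of_neg (by linarith), mul_zero, add_zero]
      exact ⟨fun _ => ih.1 hlt, fun h' => by linarith⟩
    · rw [ih.2 heq.ge, heq, sub_self, heaviside_zero]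
      have e := staircase_two_mul (L + 1)
      push_cast at e
      rw [e]
      exact ⟨fun _ => by ring, fun h' => by linarith⟩
    · rw [ih.2 hgt.le, heaviside_of_pos (by linarith)]
      refine ⟨fun h' => ?_, fun _ => by ring⟩
      rw [staircase_of_mem_Ioo (L + 1) (by push_cast; linarith) (by push_cast; linarith)]
      push_cast
      ring

/-- The staircase jumps by `2` at each even integer and takes the middle value there, hence the
weight `2` and `heaviside 0 = 1/2`. At `0` the two halves of `knotTerm` share one jump, hence the
weight `1`. -/
theorem knotSum_zero_eq_staircase (L : ℕ) {x : ℝ} (hx : |x| < 2 * (L + 1)) :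
    knotSum (L + 1) 0 x = staircase x := by
  rw [abs_lt] at hx
  rcases lt_trichotomy x 0 with h | rfl | h
  · have := (knotSum_zero_of_pos L (neg_pos.2 h)).1 (by linarith)
    rw [knotSum_zero_neg, staircase_neg] at this
    linarith
  · have := knotSum_zero_neg (L + 1) 0
    rw [neg_zero] at this
    rw [staircase_zero]
    linarith
  · exact (knotSum_zero_of_pos L h).1 hx.2

end TruncatedPowers

/-! ### The functions `φ_{f,p}` and their uniform convergence. -/

section Limit

variable {p : ℕ} [Fact p.Prime] {n : ℕ}

/-- At level `e+1` the two numerators differ by at most `p`, so the Lipschitz bound gives a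
geometric series. -/
theorem dist_phiValue_floor_succ_le (d : Fin (n + 1) → ℕ) (hd : 0 < d 0) {t : ℝ} (ht : 0 ≤ t)
    (e : ℕ) :
    dist (phiValue d p ⌊t * (p : ℝ) ^ e⌋₊ e) (phiValue d p ⌊t * (p : ℝ) ^ (e + 1)⌋₊ (e + 1)) ≤
      d 0 * (1 / (p : ℝ)) ^ e := by
  have hp : p.Prime := Fact.out
  have hp0 : (0 : ℝ) < p := by exact_mod_cast hp.pos
  rw [← phiValue_prime_mul, Real.dist_eq]
  refine (phiValue_lipschitz d hd _ _ _).trans ?_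
  have h1 := Nat.floor_le (by positivity : 0 ≤ t * (p : ℝ) ^ e)
  have h2 := Nat.lt_floor_add_one (t * (p : ℝ) ^ e)
  have h3 := Nat.floor_le (by positivity : 0 ≤ t * (p : ℝ) ^ (e + 1))
  have h4 : p * ⌊t * (p : ℝ) ^ e⌋₊ ≤ ⌊t * (p : ℝ) ^ (e + 1)⌋₊ := by
    refine Nat.le_floor ?_
    push_cast
    rw [pow_succ']
    nlinarith
  have h4' : (p : ℝ) * ⌊t * (p : ℝ) ^ e⌋₊ ≤ ⌊t * (p : ℝ) ^ (e + 1)⌋₊ := by exact_mod_cast h4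
  have h5 : t * (p : ℝ) ^ (e + 1) = p * (t * (p : ℝ) ^ e) := by ring
  have h6 : p * (t * (p : ℝ) ^ e) ≤ p * (⌊t * (p : ℝ) ^ e⌋₊ + 1) :=
    mul_le_mul_of_nonneg_left h2.le hp0.le
  have h7 : |((p * ⌊t * (p : ℝ) ^ e⌋₊ : ℕ) : ℝ) - ⌊t * (p : ℝ) ^ (e + 1)⌋₊| ≤ p := by
    push_cast
    rw [abs_le]
    constructor <;> linarith
  calc (d 0 : ℝ) / (p : ℝ) ^ (e + 1) *
        |((p * ⌊t * (p : ℝ) ^ e⌋₊ : ℕ) : ℝ) - ⌊t * (p : ℝ) ^ (e + 1)⌋₊|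
      ≤ d 0 / (p : ℝ) ^ (e + 1) * p := by gcongr
    _ = d 0 * (1 / (p : ℝ)) ^ e := by
      rw [pow_succ, one_div, inv_pow]
      field_simp

theorem tendsto_phi (d : Fin (n + 1) → ℕ) (hd : 0 < d 0) {t : ℝ} (ht : 0 ≤ t) :
    Tendsto (fun e : ℕ => phiValue d p ⌊t * (p : ℝ) ^ e⌋₊ e) atTop (𝓝 (phi d p t)) := by
  have hp : p.Prime := Fact.out
  have hp1 : (1 : ℝ) < p := by exact_mod_cast hp.one_lt
  have hr : 1 / (p : ℝ) < 1 := by rw [div_lt_one (by linarith)]; exact hp1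
  exact (cauchySeq_of_le_geometric _ _ hr (dist_phiValue_floor_succ_le d hd ht)).tendsto_limUnder

/-- From level `e` on the truncations of `a/p^e` are exact, so the sequence is eventually constant.
-/
theorem phi_div_pow (d : Fin (n + 1) → ℕ) (hd : 0 < d 0) (a e : ℕ) :
    phi d p ((a : ℝ) / (p : ℝ) ^ e) = phiValue d p a e := by
  have hp : p.Prime := Fact.out
  have hp0 : (0 : ℝ) < p := by exact_mod_cast hp.pos
  refine tendsto_nhds_unique (tendsto_phi d hd (by positivity)) ?_
  refine tendsto_const_nhds.congr' ?_
  filter_upwards [eventually_ge_atTop e] with m hm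
  obtain ⟨f, rfl⟩ := Nat.exists_eq_add_of_le hm
  have h : (a : ℝ) / (p : ℝ) ^ e * (p : ℝ) ^ (e + f) = ((p ^ f * a : ℕ) : ℝ) := by
    rw [pow_add]
    push_cast
    field_simp
  rw [h, Nat.floor_natCast, phiValue_prime_pow_mul]

theorem abs_phi_sub_le (d : Fin (n + 1) → ℕ) (hd : 0 < d 0) {s t : ℝ} (hs : 0 ≤ s) (ht : 0 ≤ t) :
    |phi d p s - phi d p t| ≤ d 0 * |s - t| := by
  have hp : p.Prime := Fact.out
  have hp0 : (0 : ℝ) < p := by exact_mod_cast hp.pos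
  have hp1 : (1 : ℝ) < p := by exact_mod_cast hp.one_lt
  have hl := ((tendsto_phi (p := p) d hd hs).sub (tendsto_phi (p := p) d hd ht)).abs
  have hr : Tendsto (fun e : ℕ => d 0 * |s - t| + d 0 * (1 / (p : ℝ)) ^ e) atTop
      (𝓝 (d 0 * |s - t| + d 0 * 0)) := by
    refine tendsto_const_nhds.add (tendsto_const_nhds.mul ?_)
    exact tendsto_pow_atTop_nhds_zero_of_lt_one (by positivity)
      (by rw [div_lt_one hp0]; exact hp1)
  rw [mul_zero, add_zero] at hr
  refine le_of_tendsto_of_tendsto' hl hr fun e => (phiValue_lipschitz d hd _ _ _).trans ?_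
  have hpe : (0 : ℝ) < (p : ℝ) ^ e := by positivity
  have h1 := Nat.floor_le (by positivity : 0 ≤ s * (p : ℝ) ^ e)
  have h2 := Nat.lt_floor_add_one (s * (p : ℝ) ^ e)
  have h3 := Nat.floor_le (by positivity : 0 ≤ t * (p : ℝ) ^ e)
  have h4 := Nat.lt_floor_add_one (t * (p : ℝ) ^ e)
  have h5 : |s * (p : ℝ) ^ e - t * (p : ℝ) ^ e| = |s - t| * (p : ℝ) ^ e := by
    rw [← sub_mul, abs_mul, abs_of_pos hpe]
  have h6 : |(⌊s * (p : ℝ) ^ e⌋₊ : ℝ) - ⌊t * (p : ℝ) ^ e⌋₊| ≤ |s - t| * (p : ℝ) ^ e + 1 := by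
    have h7 := abs_le.1 h5.le
    rw [abs_le]
    constructor <;> linarith [h7.1, h7.2]
  calc (d 0 : ℝ) / (p : ℝ) ^ e * |(⌊s * (p : ℝ) ^ e⌋₊ : ℝ) - ⌊t * (p : ℝ) ^ e⌋₊|
      ≤ d 0 / (p : ℝ) ^ e * (|s - t| * (p : ℝ) ^ e + 1) := by gcongr
    _ = d 0 * |s - t| + d 0 * (1 / (p : ℝ)) ^ e := by
      rw [one_div, inv_pow]
      field_simp

theorem continuousOn_phi (d : Fin (n + 1) → ℕ) (hd : 0 < d 0) :
    ContinuousOn (phi d p) (Icc 0 1) := by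
  refine LipschitzOnWith.continuousOn (K := d 0) (LipschitzOnWith.of_dist_le_mul ?_)
  intro s hs t ht
  rw [Real.dist_eq, Real.dist_eq]
  exact abs_phi_sub_le d hd hs.1 ht.1

theorem exists_abs_phi_sub_phiLimit_le (d : Fin (n + 1) → ℕ) (hd : ∀ i, 0 < d i) :
    ∃ c : ℝ, ∀ p : ℕ, p.Prime → ∀ t ∈ Icc (0 : ℝ) 1, |phi d p t - phiLimit d t| ≤ c / p := by
  have hB := abs_knotSum_zero_le (n + 1 + 1)
  set B := ∑ l ∈ Finset.range (n + 1 + 1), reflWeight l * 2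
  have hB0 : 0 ≤ B := (abs_nonneg _).trans (hB 0)
  obtain ⟨c, hc⟩ := exists_abs_iterBlockSum_sub_le (knotSum_zero_mono (n + 1 + 1)) hB d hd
  -- The three constants: moving `t` to `⌊t p⌋ / p` in `phi`, the Riemann sum error there, and
  -- moving back in the limit function.
  refine ⟨d 0 + c + d 0 * B, fun p hp t ht => ?_⟩
  have : Fact p.Prime := ⟨hp⟩
  have hp0 : (0 : ℝ) < p := by exact_mod_cast hp.pos
  set a := ⌊t * p⌋₊ with ha
  have h1 : (a : ℝ) ≤ t * p := Nat.floor_le (mul_nonneg ht.1 hp0.le)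
  have h2 : t * p < a + 1 := Nat.lt_floor_add_one _
  have hap : a ≤ p := by
    have h : (a : ℝ) ≤ p := h1.trans (mul_le_of_le_one_left hp0.le ht.2)
    exact_mod_cast h
  have hx0 : (0 : ℝ) ≤ a / p := by positivity
  have hx1 : (a : ℝ) / p ≤ 1 := by
    rw [div_le_one hp0]
    exact_mod_cast hap
  have hta : |t - a / p| ≤ 1 / p := by
    rw [abs_le]
    constructor
    · have : (a : ℝ) / p ≤ t := by rwa [div_le_iff₀ hp0]
      have : (0 : ℝ) < 1 / p := by positivity
      linarith
    · rw [sub_le_iff_le_add, ← add_div, le_div_iff₀ hp0]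
      linarith
  have k1 : |phi d p t - phi d p (a / p)| ≤ d 0 * (1 / p) :=
    (abs_phi_sub_le d (hd 0) ht.1 hx0).trans (by gcongr)
  have k2 : phi d p (a / p) = iterBlockSum p d (knotSum (n + 1 + 1) 0) (a / p) / (p : ℝ) ^ (n + 1) := by
    have e := phi_div_pow (p := p) d (hd 0) a 1
    rw [pow_one] at e
    rw [e, phiValue_one_eq d hd hap]
    congr 1
    refine iterBlockSum_congr hp.pos d (K := 1) (fun x hx => ?_) _ (by rwa [abs_of_nonneg hx0])
    refine (knotSum_zero_eq_staircase (n + 1) (lt_of_le_of_lt hx ?_)).symm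
    push_cast
    linarith [(Nat.cast_nonneg n : (0 : ℝ) ≤ n)]
  have k3 := hc p hp.pos (a / p)
  rw [← k2] at k3
  have k4 : |iterWindowAvg d (knotSum (n + 1 + 1) 0) (a / p) -
      iterWindowAvg d (knotSum (n + 1 + 1) 0) t| ≤ d 0 * B * (1 / p) := by
    refine (abs_iterWindowAvg_sub_le (knotSum_zero_mono _) hB d hd _ _).trans ?_
    rw [abs_sub_comm]
    gcongr
  rw [phiLimit_eq_iterWindowAvg (by omega) d ht]
  have e : (d 0 + c + d 0 * B) / (p : ℝ) = d 0 * (1 / p) + c / p + d 0 * B * (1 / p) := by ring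
  rw [e]
  exact (abs_sub_le _ _ _).trans
    ((add_le_add ((abs_sub_le _ _ _).trans (add_le_add k1 k3)) k4))

theorem tendstoUniformlyOn_phi (d : Fin (n + 1) → ℕ) (hd : ∀ i, 0 < d i) :
    TendstoUniformlyOn (fun p : ℕ => phi d p) (phiLimit d) (atTop ⊓ 𝓟 {p : ℕ | p.Prime})
      (Icc 0 1) := by
  obtain ⟨c, hc⟩ := exists_abs_phi_sub_phiLimit_le d hd
  rw [Metric.tendstoUniformlyOn_iff]
  intro ε hε
  rw [eventually_inf_principal]
  filter_upwards [(tendsto_const_div_atTop_nhds_zero_nat c).eventually_lt_const hε]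
    with p hpε hp t ht
  rw [dist_comm, Real.dist_eq]
  exact (hc p hp t ht).trans_lt hpε

end Limit

/-! ### Piecewise polynomiality on the grid of step `1 / (d_1 ⋯ d_n)`. -/

section Piecewise

variable {n : ℕ}

/-- With `N = ∏ d_j`, the form times `N` is `±tN` plus an integer, so it can change sign only where
`tN` is an integer. -/
theorem signForm_sign (d : Fin n → ℕ) (hd : ∀ i, 0 < d i) (l : ℕ) (ε : Fin (n + 1) → ℤˣ) (i : ℕ) :
    (∀ t ∈ Icc ((i : ℝ) / (∏ j, d j : ℕ)) ((i + 1 : ℕ) / (∏ j, d j : ℕ)), 0 ≤ signForm d l ε t) ∨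
      ∀ t ∈ Icc ((i : ℝ) / (∏ j, d j : ℕ)) ((i + 1 : ℕ) / (∏ j, d j : ℕ)),
        signForm d l ε t ≤ 0 := by
  set N : ℕ := ∏ j, d j with hN
  have hN0 : (0 : ℝ) < N := by exact_mod_cast Finset.prod_pos fun j _ => hd j
  obtain ⟨R, hR⟩ : ∃ R : ℤ, ∑ j : Fin n, ((ε j.succ : ℤ) : ℝ) / (d j : ℝ) - 2 * (l : ℝ) = R / N := by
    have hdvd : ∀ j, d j ∣ N := fun j => Finset.dvd_prod_of_mem d (Finset.mem_univ j)
    choose c hc using hdvd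
    refine ⟨∑ j : Fin n, (ε j.succ : ℤ) * (c j : ℤ) - 2 * l * N, ?_⟩
    push_cast
    rw [sub_div, Finset.sum_div, mul_div_assoc, div_self hN0.ne', mul_one]
    congr 1
    refine Finset.sum_congr rfl fun j _ => ?_
    have hdj : (d j : ℝ) ≠ 0 := by exact_mod_cast (hd j).ne'
    have hcj : (N : ℝ) = d j * c j := by exact_mod_cast hc j
    rw [div_eq_div_iff hdj hN0.ne', hcj]
    ring
  have hform : ∀ t, signForm d l ε t = (((ε 0 : ℤ) : ℝ) * (t * N) + R) / N := fun t => by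
    rw [signForm, add_sub_assoc, hR]
    field_simp
  have ht : ∀ t ∈ Icc ((i : ℝ) / N) ((i + 1 : ℕ) / N), (i : ℝ) ≤ t * N ∧ t * N ≤ i + 1 := by
    rintro t ⟨h1, h2⟩
    rw [div_le_iff₀ hN0] at h1
    rw [le_div_iff₀ hN0] at h2
    push_cast at h2
    exact ⟨h1, h2⟩
  -- The end values are consecutive integers, so they cannot have strictly opposite signs.
  have hcase : (0 ≤ (ε 0 : ℤ) * (i : ℤ) + R ∧ 0 ≤ (ε 0 : ℤ) * ((i : ℤ) + 1) + R) ∨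
      ((ε 0 : ℤ) * (i : ℤ) + R ≤ 0 ∧ (ε 0 : ℤ) * ((i : ℤ) + 1) + R ≤ 0) := by
    rcases Int.units_eq_one_or (ε 0) with h | h <;> rw [h] <;> simp <;> omega
  rcases hcase with ⟨h1, h2⟩ | ⟨h1, h2⟩
  · left
    intro t hti
    obtain ⟨h3, h4⟩ := ht t hti
    rw [hform]
    refine div_nonneg ?_ hN0.le
    have h1' : (0 : ℝ) ≤ ((ε 0 : ℤ) : ℝ) * i + R := by exact_mod_cast h1
    have h2' : (0 : ℝ) ≤ ((ε 0 : ℤ) : ℝ) * (i + 1) + R := by exact_mod_cast h2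
    rcases Int.units_eq_one_or (ε 0) with h | h <;> rw [h] at h1' h2' ⊢ <;> simp at h1' h2' ⊢ <;>
      linarith
  · right
    intro t hti
    obtain ⟨h3, h4⟩ := ht t hti
    rw [hform]
    refine div_nonpos_of_nonpos_of_nonneg ?_ hN0.le
    have h1' : ((ε 0 : ℤ) : ℝ) * i + R ≤ 0 := by exact_mod_cast h1
    have h2' : ((ε 0 : ℤ) : ℝ) * (i + 1) + R ≤ 0 := by exact_mod_cast h2
    rcases Int.units_eq_one_or (ε 0) with h | h <;> rw [h] at h1' h2' ⊢ <;> simp at h1' h2' ⊢ <;>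
      linarith

theorem exists_polynomial_C (hn : 1 ≤ n) (d : Fin n → ℕ) (hd : ∀ i, 0 < d i) (l i : ℕ) :
    ∃ P : Polynomial ℝ, ∀ t ∈ Icc ((i : ℝ) / (∏ j, d j : ℕ)) ((i + 1 : ℕ) / (∏ j, d j : ℕ)),
      C d l t = P.eval t := by
  have key : ∀ ε : Fin (n + 1) → ℤˣ, ∃ P : Polynomial ℝ,
      ∀ t ∈ Icc ((i : ℝ) / (∏ j, d j : ℕ)) ((i + 1 : ℕ) / (∏ j, d j : ℕ)),
      (if 0 ≤ signForm d l ε t then (∏ j, ((ε j : ℤ) : ℝ)) * signForm d l ε t ^ n else 0) =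
        P.eval t := fun ε => by
    rcases signForm_sign d hd l ε i with h | h
    · refine ⟨Polynomial.C (∏ j, ((ε j : ℤ) : ℝ)) * (Polynomial.C ((ε 0 : ℤ) : ℝ) * Polynomial.X +
        Polynomial.C (∑ i : Fin n, ((ε i.succ : ℤ) : ℝ) / (d i : ℝ)) -
          Polynomial.C (2 * (l : ℝ))) ^ n, fun t ht => ?_⟩
      rw [if_pos (h t ht)]
      simp only [Polynomial.eval_mul, Polynomial.eval_pow, Polynomial.eval_add, Polynomial.eval_sub,
        Polynomial.eval_C, Polynomial.eval_X, signForm]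
    · refine ⟨0, fun t ht => ?_⟩
      rw [Polynomial.eval_zero]
      split_ifs with h0
      -- A term included at an end point has vanishing form, and `0 ^ n = 0` because `n ≥ 1`; this
      -- is what permits closed subintervals.
      · rw [le_antisymm (h t ht) h0, zero_pow (by omega), mul_zero]
      · rfl
  choose P hP using key
  refine ⟨∑ ε, P ε, fun t ht => ?_⟩
  rw [C, Finset.sum_filter, Polynomial.eval_finsetSum]
  exact Finset.sum_congr rfl fun ε _ => hP ε t ht

theorem isPiecewisePolynomialOn_of_grid {N : ℕ} (hN : 0 < N) {g : ℝ → ℝ}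
    (h : ∀ i < N, ∃ P : Polynomial ℝ, ∀ t ∈ Icc ((i : ℝ) / N) ((i + 1 : ℕ) / N), g t = P.eval t) :
    IsPiecewisePolynomialOn g 0 1 := by
  have hN0 : (0 : ℝ) < N := by exact_mod_cast hN
  refine ⟨N, fun i => (i : ℝ) / N, fun i j hij => ?_, by simp, div_self hN0.ne', h⟩
  have : (i : ℝ) ≤ j := by exact_mod_cast hij
  simp only
  gcongr

theorem isPiecewisePolynomialOn_C (hn : 1 ≤ n) (d : Fin n → ℕ) (hd : ∀ i, 0 < d i) (l : ℕ) :
    IsPiecewisePolynomialOn (C d l) 0 1 :=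
  isPiecewisePolynomialOn_of_grid (Finset.prod_pos fun j _ => hd j) fun i _ =>
    exists_polynomial_C hn d hd l i

theorem isPiecewisePolynomialOn_phiLimit (hn : 1 ≤ n) (d : Fin n → ℕ) (hd : ∀ i, 0 < d i) :
    IsPiecewisePolynomialOn (phiLimit d) 0 1 := by
  have hN : 0 < ∏ j, d j := Finset.prod_pos fun j _ => hd j
  have hN0 : (0 : ℝ) < (∏ j, d j : ℕ) := by exact_mod_cast hN
  refine isPiecewisePolynomialOn_of_grid hN fun i hi => ?_
  choose P hP using fun l => exists_polynomial_C hn d hd l i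
  refine ⟨Polynomial.C ((∏ i, (d i : ℝ)) / (2 ^ n * (n.factorial : ℝ))) *
    ∑ l ∈ Finset.range (n + 1), Polynomial.C (reflWeight l) * P l, fun t ht => ?_⟩
  have ht' : t ∈ Icc (0 : ℝ) 1 := by
    refine ⟨le_trans (by positivity) ht.1, ht.2.trans ?_⟩
    rw [div_le_one hN0]
    exact_mod_cast hi
  rw [phiLimit_eq_sum d ht', Polynomial.eval_mul, Polynomial.eval_C, Polynomial.eval_finsetSum]
  congr 1
  refine Finset.sum_congr rfl fun l _ => ?_
  rw [Polynomial.eval_mul, Polynomial.eval_C, hP l t ht]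

theorem finite_setOf_C_ne_zero (d : Fin n → ℕ) {t : ℝ} (ht : t ∈ Icc (0 : ℝ) 1) :
    {l : ℕ | C d l t ≠ 0}.Finite := by
  refine (Set.finite_Iic n).subset fun l hl => ?_
  by_contra h
  exact hl (C_eq_zero_of_lt d (not_le.1 h) ht)

end Piecewise

end DiagonalHypersurface

end

theorem theorem3p2 (n : ℕ) (hn : 1 ≤ n) (d : Fin n → ℕ) (hd : ∀ i, 2 ≤ d i) :
    -- `phi d p` is the continuous extension to `[0,1]` of the function `a/p^e ↦ p^{-ne} dim (⋯)`
    (∀ p : ℕ, p.Prime →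
      ContinuousOn (DiagonalHypersurface.phi d p) (Icc 0 1) ∧
      ∀ a e : ℕ, a ≤ p ^ e →
        DiagonalHypersurface.phi d p ((a : ℝ) / (p : ℝ) ^ e) =
          DiagonalHypersurface.phiValue d p a e) ∧
    -- uniform convergence on `[0,1]` as the prime `p` tends to infinity
    TendstoUniformlyOn (fun p : ℕ => DiagonalHypersurface.phi d p)
      (DiagonalHypersurface.phiLimit d) (atTop ⊓ 𝓟 {p : ℕ | p.Prime}) (Icc 0 1) ∧
    -- the sum over `l ≥ 1` in the limit function has only finitely many nonzero terms
    (∀ t ∈ Icc (0 : ℝ) 1, {l : ℕ | DiagonalHypersurface.C d l t ≠ 0}.Finite) ∧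
    -- the functions `C_l` and the limit function are piecewise polynomial
    (∀ l : ℕ, DiagonalHypersurface.IsPiecewisePolynomialOn (DiagonalHypersurface.C d l) 0 1) ∧
    DiagonalHypersurface.IsPiecewisePolynomialOn (DiagonalHypersurface.phiLimit d) 0 1 := by
  have hd0 : ∀ i, 0 < d i := fun i => lt_of_lt_of_le two_pos (hd i)
  obtain ⟨m, rfl⟩ : ∃ m, n = m + 1 := ⟨n - 1, by omega⟩
  refine ⟨fun p hp => ?_, DiagonalHypersurface.tendstoUniformlyOn_phi d hd0,
    fun t ht => DiagonalHypersurface.finite_setOf_C_ne_zero d ht,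
    DiagonalHypersurface.isPiecewisePolynomialOn_C hn d hd0,
    DiagonalHypersurface.isPiecewisePolynomialOn_phiLimit hn d hd0⟩
  have : Fact p.Prime := ⟨hp⟩
  exact ⟨DiagonalHypersurface.continuousOn_phi d (hd0 0),
    fun a e _ => DiagonalHypersurface.phi_div_pow d (hd0 0) a e⟩
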